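/- Let $\alpha,\beta:\mathbb N\to\mathbb R$ ($\mathbb N=\{0,1,2,\dots\}$) satisfy $\alpha(x)>0$ for $x\ge 0$, $\beta(0)=0$, $\beta(x)>0$ for $x\ge1$, and $$\sum_{x\ge1}\frac{\alpha(0)\cdots\alpha(x-1)}{\beta(1)\cdots\beta(x)}<\infty,\qquad \sum_{x\ge1}\Big(\frac1{\alpha(x)}+\frac{\beta(x)}{\alpha(x)\alpha(x-1)}+\dots+\frac{\beta(x)\cdots\beta(1)}{\alpha(x)\cdots\alpha(0)}\Big)=\infty ,$$ and let $P_tf(x)=\mathbb E[f(X^x_t)]$ be the semigroup of the birth-death process on $\mathbb N$ with birth rates $\alpha$ and death rates $\beta$. Let $u,v$ be positive sequences on $\mathbb N$. For $f:\mathbb N\to\mathbb R$ put $\partial_uf(x)=\frac{f(x+1)-f(x)}{u(x)}$ for $x\ge0$, $\partial^*_vf(x)=\frac{f(x-1)-f(x)}{v(x)}$ for $x\ge1$, and $\partial_v^*f(0)=-\frac{f(0)}{v(0)}$. Put $$V_u(x)=\alpha(x)-\frac{u(x+1)}{u(x)}\alpha(x+1)+\beta(x+1)-\frac{u(x-1)}{u(x)}\beta(x)\mathbf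 1_{x\ge1},\qquad x\ge0,$$ and assume that $V_u$ is non-increasing. Consider the jump process $X_{u,*v}$ on $\mathbb N$ (defined up to its explosion time, if that is finite) with the following jump rates: from $x\ge0$ to $x+1$ at rate $\frac{v(x+1)}{v(x)}\frac{u(x+1)}{u(x)}\alpha(x+1)$; from $x\ge2$ to $x-1$ at rate $\frac{v(x-1)}{v(x)}\frac{u(x-2)}{u(x-1)}\beta(x-1)+v(x-1)\,\partial_v^*V_u(x)$; from $1$ to $0$ at rate $v(0)\,\partial_v^*V_u(1)$; and from $x\ge2$ to each $k\in\{0,\dots,x-2\}$ at rate $v(k)\,\partial_v^*V_u(x)$. Let $$V_{u,*v}(0)=\alpha(0)-\Big(1+\frac{v(1)}{v(0)}\Big)\frac{u(1)}{u(0)}\alpha(1)+\beta(1)$$ and, for $x\ge1$ (the term containing $\beta(x-1)$ being $0$ for $x=1$), $$V_{u,*v}(x)=\Big(1+\frac{u(x)}{u(x-1)}\Big)\alpha(x)-\Big(1+\frac{v(x+1)}{v(x)}\Big)\frac{u(x+1)}{u(x)}\alpha(x+1)+\beta(x+1)-\frac{v(x-1)}{v(x)}\frac{u(x-2)}{u(x-1)}\beta(x-1)-\Big(\sum_{j=0}^{x-1}v(j)\Big)\partial_v^*V_u(x).$$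 Let $$P^{V_{u,*v}}_{u,*v,t}g(x)=\mathbb E\Big[g(X^x_{u,*v,t})\,e^{-\int_0^tV_{u,*v}(X^x_{u,*v,s})\,ds}\Big]$$ be the Feynman-Kac semigroup of $X_{u,*v}$ with potential $V_{u,*v}$ (the integrand being $0$ after explosion). Assume that $V_u$ is bounded from below, that $\inf_{x\in\mathbb N}v(x)>0$ and that $V_{u,*v}$ is bounded from below. Then for every $f:\mathbb N\to\mathbb R$ with $\|\partial_uf\|_\infty<\infty$ and every $t\ge0$, the expectations defining $P_tf$ and $P^{V_{u,*v}}_{u,*v,t}(\partial_v^*\partial_uf)$ are absolutely convergent and $$\partial_v^*\partial_u(P_tf)=P^{V_{u,*v}}_{u,*v,t}\,(\partial_v^*\partial_uf)\qquad\text{on }\mathbb N.$$ -/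

import Mathlib

open MeasureTheory ProbabilityTheory
open scoped ENNReal

namespace BirthDeath

noncomputable section

/-! ### Discrete gradients -/

/-- The weighted forward gradient `∂_u f (x) = (f (x+1) - f x) / u x`. -/
def fwdGrad (u f : ℕ → ℝ) (x : ℕ) : ℝ := (f (x + 1) - f x) / u x

/-- The weighted backward gradient `∂*_v f (x) = (f (x-1) - f x) / v x`, with the Dirichlet
convention `f (-1) = 0`. -/
def bwdGrad (v f : ℕ → ℝ) : ℕ → ℝ
  | 0 => -f 0 / v 0
  | x + 1 => (f x - f (x + 1)) / v (x + 1)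

/-! ### Minimal jump process on `ℕ` with given jump rates

`Q x y` is the rate of the jump from `x` to `y`; the corresponding generator is
`f ↦ ∑ y, Q x y * (f y - f x)`. The process is given by its jump chain and holding times:
from the state `x` it waits an exponential time of parameter `∑ y, Q x y` and then jumps to `y`
with probability proportional to `Q x y`. It is run up to the explosion time. -/

/-- Total jump rate out of `x`. -/
def exitRate (Q : ℕ → ℕ → ℝ) (x : ℕ) : ℝ≥0∞ := ∑' y, ENNReal.ofReal (Q x y)

open Classical in
/-- Law of the target of a jump from `x`: it is `y` with probability `Q x y / ∑ z, Q x z`.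
If `x` is absorbing (`∑ z, Q x z = 0`), the (irrelevant) convention is the Dirac mass at `x`. -/
def jumpLaw (Q : ℕ → ℕ → ℝ) (x : ℕ) : PMF ℕ :=
  if h : exitRate Q x ≠ 0 ∧ exitRate Q x ≠ ∞ then
    PMF.normalize (fun y => ENNReal.ofReal (Q x y)) h.1 h.2
  else PMF.pure x

/-- The sample space: for every step `n`, a real number (a standard exponential variable) and,
for every state `y`, the state to which the process jumps if the `n`-th jump starts in `y`. -/
abbrev Sample : Type := ℕ → ℝ × (ℕ → ℕ)

/-- All the coordinates of the sample are independent; the first component of each step is a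
standard exponential variable and the target of a jump from `y` has law `jumpLaw Q y`. -/
def sampleLaw (Q : ℕ → ℕ → ℝ) : Measure Sample :=
  Measure.infinitePi fun _ : ℕ =>
    (expMeasure 1).prod (Measure.infinitePi fun y : ℕ => (jumpLaw Q y).toMeasure)

/-- The jump chain started at `x`. -/
def jumpChain (x : ℕ) (ω : Sample) : ℕ → ℕ
  | 0 => x
  | n + 1 => (ω n).2 (jumpChain x ω n)

/-- Holding time in the `n`-th visited state: an exponential variable divided by the exit rate
(infinite in an absorbing state). -/
def holdingTime (Q : ℕ → ℕ → ℝ) (x : ℕ) (ω : Sample) (n : ℕ) : ℝ≥0∞ :=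
  ENNReal.ofReal (ω n).1 / exitRate Q (jumpChain x ω n)

/-- Time of the `n`-th jump. -/
def jumpTime (Q : ℕ → ℕ → ℝ) (x : ℕ) (ω : Sample) (n : ℕ) : ℝ≥0∞ :=
  ∑ k ∈ Finset.range n, holdingTime Q x ω k

open Classical in
/-- The position `X_t^x` at time `t` of the process started at `x`; it is `none` after the
explosion time. -/
def position (Q : ℕ → ℕ → ℝ) (x : ℕ) (t : ℝ) (ω : Sample) : Option ℕ :=
  if h : ∃ n, ENNReal.ofReal t < jumpTime Q x ω (n + 1) then some (jumpChain x ω (Nat.find h))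
  else none

/-- The value `g (X_t^x)`, with value `0` after explosion. -/
def valueAt (Q : ℕ → ℕ → ℝ) (g : ℕ → ℝ) (x : ℕ) (t : ℝ) (ω : Sample) : ℝ :=
  (position Q x t ω).elim 0 g

/-- The semigroup `P_t f (x) = 𝔼[f (X_t^x)]`. -/
def semigroup (Q : ℕ → ℕ → ℝ) (t : ℝ) (f : ℕ → ℝ) (x : ℕ) : ℝ :=
  ∫ ω, valueAt Q f x t ω ∂(sampleLaw Q)

/-- The random variable `f (X_t^x) * exp (-∫₀ᵗ V (X_s^x) ds)`. -/
def feynmanKacVar (Q : ℕ → ℕ → ℝ) (V : ℕ → ℝ) (t : ℝ) (f : ℕ → ℝ) (x : ℕ) (ω : Sample) : ℝ :=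
  valueAt Q f x t ω * Real.exp (-∫ s in (0 : ℝ)..t, valueAt Q V x s ω)

/-- The Feynman-Kac semigroup `P_t^V f (x) = 𝔼[f (X_t^x) * exp (-∫₀ᵗ V (X_s^x) ds)]`. -/
def feynmanKac (Q : ℕ → ℕ → ℝ) (V : ℕ → ℝ) (t : ℝ) (f : ℕ → ℝ) (x : ℕ) : ℝ :=
  ∫ ω, feynmanKacVar Q V t f x ω ∂(sampleLaw Q)

/-! ### The birth-death process and the modified objects -/

/-- Jump rates of the birth-death process with birth rates `α` and death rates `β`. -/
def bdRates (α β : ℕ → ℝ) (x y : ℕ) : ℝ :=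
  if y = x + 1 then α x else if y + 1 = x then β x else 0

/-- Birth rate `α_u`. -/
def alphaU (α u : ℕ → ℝ) (x : ℕ) : ℝ := u (x + 1) / u x * α (x + 1)

/-- Death rate `β_u`. -/
def betaU (β u : ℕ → ℝ) : ℕ → ℝ
  | 0 => 0
  | x + 1 => u x / u (x + 1) * β (x + 1)

/-- The first order potential `V_u`. -/
def potU (α β u : ℕ → ℝ) (x : ℕ) : ℝ :=
  α x - alphaU α u x + β (x + 1) - betaU β u x

/-- Birth rate `α_{u,*v}`. -/
def alphaUV (α u v : ℕ → ℝ) (x : ℕ) : ℝ :=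
  v (x + 1) / v x * (u (x + 1) / u x) * α (x + 1)

/-- Death rate `β_{u,*v}`. -/
def betaUV (α β u v : ℕ → ℝ) : ℕ → ℝ
  | 0 => 0
  | 1 => v 0 * bwdGrad v (potU α β u) 1
  | x + 2 => v (x + 1) / v (x + 2) * (u x / u (x + 1)) * β (x + 1)
      + v (x + 1) * bwdGrad v (potU α β u) (x + 2)

/-- Jump rates of the modified process: births at rate `α_{u,*v}`, deaths at rate `β_{u,*v}` and
jumps from `x ≥ 2` to each `k ≤ x - 2` at rate `(∂*_v V_u)(x) * v k`. -/
def ratesUV (α β u v : ℕ → ℝ) (x y : ℕ) : ℝ :=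
  if y = x + 1 then alphaUV α u v x
  else if y + 1 = x then betaUV α β u v x
  else if y + 2 ≤ x then bwdGrad v (potU α β u) x * v y
  else 0

/-- The second order potential `V_{u,*v}`. At the state `1`, the factor `u (x - 1)` below stands
for `u (-1)`; it is multiplied by the death rate `β 0`, which is zero. -/
def potUV (α β u v : ℕ → ℝ) : ℕ → ℝ
  | 0 => α 0 - (1 + v 1 / v 0) * (u 1 / u 0) * α 1 + β 1
  | x + 1 => (1 + u (x + 1) / u x) * α (x + 1)
      - (1 + v (x + 2) / v (x + 1)) * (u (x + 2) / u (x + 1)) * α (x + 2)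
      + β (x + 2)
      - v x / v (x + 1) * (u (x - 1) / u x) * β x
      - (∑ j ∈ Finset.range (x + 1), v j) * bwdGrad v (potU α β u) (x + 1)

/-- Ergodicity condition:
`∑_{x ≥ 1} α(0)⋯α(x-1) / (β(1)⋯β(x)) < ∞`. -/
def ErgodicRates (α β : ℕ → ℝ) : Prop :=
  Summable fun x : ℕ => ∏ y ∈ Finset.range (x + 1), α y / β (y + 1)

/-- Non-explosion condition:
`∑_{x ≥ 1} ∑_{k=0}^{x} β(x)⋯β(k+1) / (α(x)⋯α(k)) = ∞`. -/
def NonExplosiveRates (α β : ℕ → ℝ) : Prop :=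
  ¬ Summable fun x : ℕ => ∑ k ∈ Finset.range (x + 2),
    (∏ j ∈ Finset.Ioc k (x + 1), β j) / ∏ j ∈ Finset.Icc k (x + 1), α j

end

end BirthDeath

/-!
The generator `L` of the birth-death process satisfies `∂_u L = A ∂_u`, where `A` is the generator
with rates `α_u`, `β_u` and potential `V_u` (`fwdGrad_bdOp`), and `∂*_v A = B ∂*_v`, where `B` is
the generator with rates `ratesUV` and potential `V_{u,*v}` (`bwdGrad_bdOp`). So `∂*_v ∂_u P_t f`
formally solves the backward equation of the Feynman-Kac semigroup. That equation may have several
solutions, since no explosion criterion is available for the modified process, so the identity is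
obtained from finite systems instead.

* The Feynman-Kac semigroup of the minimal process is the limit of the semigroups killed outside
  of `{0, …, N - 1}`, which are matrix exponentials (`lintegral_feynmanKacVar`,
  `integrable_and_tendsto_killedFlow`). Conditioning on the first jump shows that the
  expectations restricted to fewer than `n` jumps are the iterates of an integral equation
  (`truncFKMean_succ`); the killed semigroups solve the same equation up to truncation.
* On finite systems the gradients exchange reflection and killing. The gradient `∂_u` of the
  birth-death semigroup reflected at `n` solves the equation of `A` killed at `n`, whereas
  integrating the semigroup of `B` killed at `n` gives a solution of the equation of `A` reflected
  at `n - 1`. By the maximum principle both are bounded uniformly in `n`, as `V_u` is bounded from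
  below; here `V_u` non-increasing is what makes the rates of `B` nonnegative.
* The function `x ↦ ∑_{k ≤ x} v k` is a Lyapunov function of `A`, because `V_{u,*v}` is bounded from
  below (`bdOp_weight_le`), and it tends to infinity, because `inf v > 0`. Hence the two solutions
  have the same limit (`tendsto_summedFlow_sub`).
* For bounded `f` the reflected birth-death semigroups converge to `P_t f` by non-explosion
  (`tendsto_reflectedFlow`). The general case follows by dominated convergence from the functions
  `f (min · m)`; the Lyapunov function `x ↦ 1 + ∑_{k < x} u k` (`bdOp_sum_le`) yields integrability.
-/

namespace BirthDeath

/-! ### Linear flows on initial segments of `ℕ` and the maximum principle -/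

/-- The operator on functions on `{0, …, n - 1}` with matrix `a`. -/
noncomputable def truncOp (a : ℕ → ℕ → ℝ) (n : ℕ) : (Fin n → ℝ) →L[ℝ] (Fin n → ℝ) :=
  LinearMap.toContinuousLinearMap (Matrix.toLin' (Matrix.of fun i j : Fin n => a i j))

/-- The solution at time `t` of the linear system `w' = a w` on `{0, …, n - 1}` started from `g`,
extended by `0` to `ℕ`. -/
noncomputable def linFlow (a : ℕ → ℕ → ℝ) (n : ℕ) (g : ℕ → ℝ) (t : ℝ) (x : ℕ) : ℝ :=
  if h : x < n then NormedSpace.exp (t • truncOp a n) (fun i : Fin n => g i) ⟨x, h⟩ else 0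

lemma linFlow_of_le {a : ℕ → ℕ → ℝ} {n : ℕ} {g : ℕ → ℝ} {t : ℝ} {x : ℕ} (h : n ≤ x) :
    linFlow a n g t x = 0 := dif_neg (by omega)

lemma linFlow_zero {a : ℕ → ℕ → ℝ} {n : ℕ} {g : ℕ → ℝ} {x : ℕ} (h : x < n) :
    linFlow a n g 0 x = g x := by
  simp [linFlow, h]

lemma linFlow_sub (a : ℕ → ℕ → ℝ) (n : ℕ) (g₁ g₂ : ℕ → ℝ) (t : ℝ) (x : ℕ) :
    linFlow a n (fun y => g₁ y - g₂ y) t x = linFlow a n g₁ t x - linFlow a n g₂ t x := by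
  unfold linFlow
  split_ifs with h
  · have : (fun i : Fin n => g₁ i - g₂ i) = (fun i : Fin n => g₁ i) - (fun i : Fin n => g₂ i) := rfl
    rw [this, map_sub, Pi.sub_apply]
  · simp

lemma hasDerivAt_linFlow (a : ℕ → ℕ → ℝ) (n : ℕ) (g : ℕ → ℝ) (t : ℝ) {x : ℕ} (h : x < n) :
    HasDerivAt (fun s => linFlow a n g s x)
      (∑ y ∈ Finset.range n, a x y * linFlow a n g t y) t := by
  have h1 := hasDerivAt_exp_smul_const' (𝕂 := ℝ) (truncOp a n) t
  have h2 := (ContinuousLinearMap.apply ℝ (Fin n → ℝ)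
    (fun i : Fin n => g i)).hasFDerivAt.comp_hasDerivAt t h1
  have h3 := (hasDerivAt_pi.1 h2) ⟨x, h⟩
  have e1 : (fun s => linFlow a n g s x)
      = fun s => NormedSpace.exp (s • truncOp a n) (fun i : Fin n => g i) ⟨x, h⟩ := by
    funext s; simp [linFlow, h]
  rw [e1]
  refine h3.congr_deriv ?_
  simp only [ContinuousLinearMap.apply_apply, mul_apply_eq_comp]
  rw [truncOp, LinearMap.coe_toContinuousLinearMap', Matrix.toLin'_apply, Matrix.mulVec, dotProduct,
    Finset.sum_range]
  refine Finset.sum_congr rfl fun i _ => ?_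
  simp [linFlow, truncOp]

lemma hasDerivAt_min_zero_sq (y : ℝ) :
    HasDerivAt (fun z : ℝ => (min z 0) ^ 2) (2 * min y 0) y := by
  rcases lt_trichotomy y 0 with h | h | h
  · have : HasDerivAt (fun z : ℝ => z ^ 2) (2 * min y 0) y := by
      simpa [min_eq_left h.le] using hasDerivAt_pow 2 y
    refine this.congr_of_eventuallyEq ?_
    filter_upwards [gt_mem_nhds h] with z hz
    rw [min_eq_left hz.le]
  · subst h
    rw [hasDerivAt_iff_isLittleO]
    have h2 : (fun z : ℝ => z ^ 2) =o[nhds 0] (fun z : ℝ => z - 0) := by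
      simpa using (hasDerivAt_iff_isLittleO.1 (hasDerivAt_pow 2 (0 : ℝ)))
    refine Asymptotics.IsBigO.trans_isLittleO (Asymptotics.IsBigO.of_bound 1 ?_) h2
    refine Filter.Eventually.of_forall fun z => ?_
    rcases le_total z 0 with hz | hz
    · simp [min_eq_left hz]
    · simp [min_eq_right hz]
      positivity
  · have : HasDerivAt (fun _ : ℝ => (0 : ℝ)) (2 * min y 0) y := by
      simpa [min_eq_right h.le] using hasDerivAt_const y (0 : ℝ)
    refine this.congr_of_eventuallyEq ?_
    filter_upwards [lt_mem_nhds h] with z hz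
    rw [min_eq_right hz.le]; simp

/-- The maximum principle: a family of functions which is nonnegative at time `0` stays so if
each member that is negative decreases at most linearly in the negative parts of all of them. The
sum of the squares of the negative parts satisfies a Gronwall inequality. -/
lemma nonneg_of_deriv_ge {n : ℕ} {E E' : ℝ → ℕ → ℝ} {C : ℝ} (hC : 0 ≤ C)
    (hd : ∀ t, 0 ≤ t → ∀ x < n, HasDerivAt (fun s => E s x) (E' t x) t)
    (h0 : ∀ x < n, 0 ≤ E 0 x)
    (hE : ∀ t, 0 ≤ t → ∀ x < n, E t x < 0 →
      C * ∑ y ∈ Finset.range n, min (E t y) 0 ≤ E' t x)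
    {t : ℝ} (ht : 0 ≤ t) {x : ℕ} (hx : x < n) : 0 ≤ E t x := by
  set p : ℝ → ℝ := fun t => ∑ y ∈ Finset.range n, (min (E t y) 0) ^ 2 with hp
  have hpd : ∀ t, 0 ≤ t → HasDerivAt p
      (∑ y ∈ Finset.range n, 2 * min (E t y) 0 * E' t y) t := by
    intro t ht
    refine HasDerivAt.fun_sum fun y hy => ?_
    exact (hasDerivAt_min_zero_sq (E t y)).comp t (hd t ht y (Finset.mem_range.1 hy))
  have hbound : ∀ t, 0 ≤ t →
      ∑ y ∈ Finset.range n, 2 * min (E t y) 0 * E' t y ≤ 2 * C * n * p t := by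
    intro t ht
    have h1 : ∀ y ∈ Finset.range n, 2 * min (E t y) 0 * E' t y
        ≤ 2 * min (E t y) 0 * (C * ∑ z ∈ Finset.range n, min (E t z) 0) := by
      intro y hy
      rcases lt_or_ge (E t y) 0 with h | h
      · have := hE t ht y (Finset.mem_range.1 hy) h
        rw [min_eq_left h.le]
        nlinarith
      · simp [min_eq_right h]
    refine (Finset.sum_le_sum h1).trans ?_
    rw [← Finset.sum_mul, ← Finset.mul_sum]
    have h2 := sq_sum_le_card_mul_sum_sq (s := Finset.range n) (f := fun y => min (E t y) 0)
    rw [Finset.card_range] at h2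
    calc _ = 2 * C * (∑ z ∈ Finset.range n, min (E t z) 0) ^ 2 := by ring
      _ ≤ 2 * C * (n * p t) := by gcongr
      _ = _ := by ring
  have hanti : AntitoneOn (fun t => p t * Real.exp (-(2 * C * n) * t)) (Set.Ici 0) := by
    have hd' : ∀ t, 0 ≤ t → HasDerivAt (fun t => p t * Real.exp (-(2 * C * n) * t))
        ((∑ y ∈ Finset.range n, 2 * min (E t y) 0 * E' t y) * Real.exp (-(2 * C * n) * t)
          + p t * (Real.exp (-(2 * C * n) * t) * (-(2 * C * n) * 1))) t := by
      intro t ht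
      exact (hpd t ht).mul (((hasDerivAt_id t).const_mul (-(2 * C * n))).exp)
    refine antitoneOn_of_hasDerivWithinAt_nonpos (convex_Ici 0)
      (fun t ht => (hd' t ht).continuousAt.continuousWithinAt)
      (fun t ht => (hd' t (interior_subset ht)).hasDerivWithinAt) ?_
    intro t ht
    have h1 := hbound t (interior_subset ht)
    have h2 := Real.exp_pos (-(2 * C * n) * t)
    nlinarith
  have hp0 : p 0 = 0 := by
    refine Finset.sum_eq_zero fun y hy => ?_
    rw [min_eq_right (h0 y (Finset.mem_range.1 hy))]; simp
  have h1 := hanti (Set.mem_Ici.2 le_rfl) (Set.mem_Ici.2 ht) ht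
  simp only [hp0, zero_mul] at h1
  have h2 : p t ≤ 0 := by
    by_contra h
    have := mul_pos (not_le.1 h) (Real.exp_pos (-(2 * C * n) * t))
    linarith
  by_contra hneg
  have h3 : (min (E t x) 0) ^ 2 ≤ p t :=
    Finset.single_le_sum (f := fun y => (min (E t y) 0) ^ 2) (fun y _ => sq_nonneg _)
      (Finset.mem_range.2 hx)
  rw [min_eq_left (not_le.1 hneg).le] at h3
  have := sq_pos_of_neg (not_le.1 hneg)
  linarith

/-- The maximum principle for supersolutions of a linear system whose off-diagonal coefficients are
nonnegative. -/
lemma nonneg_of_deriv_ge_matrix {n : ℕ} {a : ℕ → ℕ → ℝ} (ha : ∀ x y, x ≠ y → 0 ≤ a x y)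
    {E E' : ℝ → ℕ → ℝ}
    (hd : ∀ t, 0 ≤ t → ∀ x < n, HasDerivAt (fun s => E s x) (E' t x) t)
    (h0 : ∀ x < n, 0 ≤ E 0 x)
    (hE : ∀ t, 0 ≤ t → ∀ x < n, ∑ y ∈ Finset.range n, a x y * E t y ≤ E' t x)
    {t : ℝ} (ht : 0 ≤ t) {x : ℕ} (hx : x < n) : 0 ≤ E t x := by
  refine nonneg_of_deriv_ge (C := ∑ z ∈ Finset.range n, ∑ y ∈ Finset.range n, |a z y|)
    (by positivity) hd h0 ?_ ht hx
  intro t ht x hx hneg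
  refine le_trans ?_ (hE t ht x hx)
  rw [Finset.mul_sum]
  refine Finset.sum_le_sum fun y hy => ?_
  have h1 : |a x y| ≤ ∑ z ∈ Finset.range n, ∑ y ∈ Finset.range n, |a z y| :=
    (Finset.single_le_sum (f := fun y => |a x y|) (fun _ _ => abs_nonneg _) hy).trans
      (Finset.single_le_sum (f := fun z => ∑ y ∈ Finset.range n, |a z y|)
        (fun _ _ => by positivity) (Finset.mem_range.2 hx))
  have h2 : |a x y| * min (E t y) 0 ≤ a x y * E t y := by
    rcases eq_or_ne x y with rfl | hne
    · rw [min_eq_left hneg.le]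
      exact mul_le_mul_of_nonpos_right (le_abs_self _) hneg.le
    · rw [abs_of_nonneg (ha x y hne)]
      exact mul_le_mul_of_nonneg_left (min_le_left _ _) (ha x y hne)
  exact (mul_le_mul_of_nonpos_right h1 (min_le_right _ _)).trans h2

/-- The operator `w ↦ a (w (x+1) - w x) + b (w (x-1) - w x) - V w`. At `x = 0` the second summand
vanishes, because `x - 1 = x` there. -/
def bdOp (a b V : ℕ → ℝ) (w : ℕ → ℝ) (x : ℕ) : ℝ :=
  a x * (w (x + 1) - w x) + b x * (w (x - 1) - w x) - V x * w x

/-- The maximum principle on `{0, …, n - 1}` for supersolutions of a birth-death equation with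
potential. The boundary condition holds if `E t n` is nonnegative (absorption) and if it equals
`E t (n - 1)` (reflection). -/
lemma nonneg_of_deriv_ge_bdOp {n : ℕ} {a b V : ℕ → ℝ} (ha : ∀ x, 0 ≤ a x) (hb : ∀ x, 0 ≤ b x)
    {E E' : ℝ → ℕ → ℝ}
    (hd : ∀ t, 0 ≤ t → ∀ x < n, HasDerivAt (fun s => E s x) (E' t x) t)
    (h0 : ∀ x < n, 0 ≤ E 0 x)
    (hn : ∀ t, 0 ≤ t → min (E t (n - 1)) 0 ≤ E t n)
    (hE : ∀ t, 0 ≤ t → ∀ x < n, bdOp a b V (E t) x ≤ E' t x)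
    {t : ℝ} (ht : 0 ≤ t) {x : ℕ} (hx : x < n) : 0 ≤ E t x := by
  refine nonneg_of_deriv_ge (C := ∑ z ∈ Finset.range n, (a z + b z + |V z|))
    (Finset.sum_nonneg fun z _ => by have := ha z; have := hb z; positivity) hd h0 ?_ ht hx
  intro t ht x hx hneg
  refine le_trans ?_ (hE t ht x hx)
  set S := ∑ y ∈ Finset.range n, min (E t y) 0 with hS
  have hle : ∀ y < n, S ≤ min (E t y) 0 := by
    intro y hy
    have := Finset.single_le_sum (f := fun y => -min (E t y) 0) (s := Finset.range n)
      (fun _ _ => by simp) (Finset.mem_range.2 hy)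
    rw [Finset.sum_neg_distrib] at this
    linarith
  have hS0 : S ≤ 0 := (hle x hx).trans (min_le_right _ _)
  have hC : a x + b x + |V x| ≤ ∑ z ∈ Finset.range n, (a z + b z + |V z|) :=
    Finset.single_le_sum (f := fun z => a z + b z + |V z|)
      (fun z _ => by have := ha z; have := hb z; positivity) (Finset.mem_range.2 hx)
  refine (mul_le_mul_of_nonpos_right hC hS0).trans ?_
  have h1 : S ≤ E t (x + 1) - E t x := by
    rcases Nat.lt_or_ge (x + 1) n with h | h
    · have := (hle _ h).trans (min_le_left _ _); linarith
    · have hxn : x = n - 1 := by omega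
      have := hn t ht
      rw [← hxn, min_eq_left hneg.le, show n = x + 1 by omega] at this
      linarith
  have h2 : S ≤ E t (x - 1) - E t x := by
    have := (hle (x - 1) (by omega)).trans (min_le_left _ _); linarith
  have h3 : |V x| * S ≤ -(V x * E t x) := by
    have h4 := (hle x hx).trans (min_le_left _ _)
    have h5 : |V x| * S ≤ |V x| * E t x := mul_le_mul_of_nonneg_left h4 (abs_nonneg _)
    have h6 : |V x| * E t x ≤ (-V x) * E t x := mul_le_mul_of_nonpos_right (neg_le_abs _) hneg.le
    linarith
  have h7 := mul_le_mul_of_nonneg_left h1 (ha x)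
  have h8 := mul_le_mul_of_nonneg_left h2 (hb x)
  unfold bdOp
  nlinarith

/-! ### Decomposition of the paths at the first jump -/

/-- Total jump rate out of `x`, for rates without upward jumps of size larger than one. -/
def totalRate (Q : ℕ → ℕ → ℝ) (x : ℕ) : ℝ := ∑ y ∈ Finset.range (x + 2), Q x y

/-- Nonnegative jump rates without upward jumps of size larger than one and without absorbing
states. -/
structure IsSkipFree (Q : ℕ → ℕ → ℝ) : Prop where
  nonneg : ∀ x y, 0 ≤ Q x y
  skip : ∀ x y, x + 1 < y → Q x y = 0
  pos : ∀ x, 0 < totalRate Q x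

lemma IsSkipFree.exitRate_eq {Q : ℕ → ℕ → ℝ} (hQ : IsSkipFree Q) (x : ℕ) :
    exitRate Q x = ENNReal.ofReal (totalRate Q x) := by
  rw [exitRate, totalRate, ENNReal.ofReal_sum_of_nonneg (fun y _ => hQ.nonneg x y)]
  refine tsum_eq_sum fun y hy => ?_
  rw [hQ.skip x y (by simp at hy; omega), ENNReal.ofReal_zero]

/-- The holding time in `x` for the value `e` of the exponential variable. -/
noncomputable def hold (Q : ℕ → ℕ → ℝ) (x : ℕ) (e : ℝ) : ℝ := max e 0 / totalRate Q x

/-- The sample without its first step. -/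
def shift (ω : Sample) : Sample := fun k => ω (k + 1)

lemma hold_nonneg {Q : ℕ → ℕ → ℝ} (hQ : IsSkipFree Q) (x : ℕ) (e : ℝ) : 0 ≤ hold Q x e :=
  div_nonneg (le_max_right _ _) (hQ.pos x).le

lemma jumpChain_succ (x : ℕ) (ω : Sample) (n : ℕ) :
    jumpChain x ω (n + 1) = jumpChain ((ω 0).2 x) (shift ω) n := by
  induction n with
  | zero => rfl
  | succ n ih => rw [jumpChain, ih]; rfl

lemma holdingTime_zero {Q : ℕ → ℕ → ℝ} (hQ : IsSkipFree Q) (x : ℕ) (ω : Sample) :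
    holdingTime Q x ω 0 = ENNReal.ofReal (hold Q x (ω 0).1) := by
  rw [holdingTime, jumpChain, hQ.exitRate_eq, hold, ENNReal.ofReal_div_of_pos (hQ.pos x)]
  congr 1
  rcases le_total (ω 0).1 0 with h | h
  · rw [max_eq_right h, ENNReal.ofReal_of_nonpos h, ENNReal.ofReal_zero]
  · rw [max_eq_left h]

lemma jumpTime_succ {Q : ℕ → ℕ → ℝ} (hQ : IsSkipFree Q) (x : ℕ) (ω : Sample) (n : ℕ) :
    jumpTime Q x ω (n + 1) =
      ENNReal.ofReal (hold Q x (ω 0).1) + jumpTime Q ((ω 0).2 x) (shift ω) n := by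
  rw [jumpTime, Finset.sum_range_succ', holdingTime_zero hQ, add_comm, jumpTime]
  congr 1
  refine Finset.sum_congr rfl fun k _ => ?_
  simp only [holdingTime, jumpChain_succ]
  rfl

lemma jumpTime_mono {Q : ℕ → ℕ → ℝ} (x : ℕ) (ω : Sample) : Monotone (jumpTime Q x ω) := fun _ _ h =>
  Finset.sum_le_sum_of_subset (Finset.range_mono h)

lemma lt_jumpTime_succ_iff {Q : ℕ → ℕ → ℝ} (hQ : IsSkipFree Q) {x : ℕ} {t : ℝ} {ω : Sample} (n : ℕ)
    (h : hold Q x (ω 0).1 ≤ t) :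
    ENNReal.ofReal t < jumpTime Q x ω (n + 1) ↔
      ENNReal.ofReal (t - hold Q x (ω 0).1) < jumpTime Q ((ω 0).2 x) (shift ω) n := by
  have h0 := hold_nonneg hQ x (ω 0).1
  have : ENNReal.ofReal t = ENNReal.ofReal (hold Q x (ω 0).1)
      + ENNReal.ofReal (t - hold Q x (ω 0).1) := by
    rw [← ENNReal.ofReal_add h0 (by linarith)]; congr 1; ring
  rw [this, jumpTime_succ hQ, ENNReal.add_lt_add_iff_left ENNReal.ofReal_ne_top]

lemma lt_jumpTime_one {Q : ℕ → ℕ → ℝ} (hQ : IsSkipFree Q) {x : ℕ} {t : ℝ} {ω : Sample} (h0 : 0 ≤ t)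
    (h : t < hold Q x (ω 0).1) :
    ENNReal.ofReal t < jumpTime Q x ω 1 := by
  rw [jumpTime_succ hQ]
  exact ((ENNReal.ofReal_lt_ofReal_iff (h0.trans_lt h)).2 h).trans_le le_self_add

lemma position_of_lt {Q : ℕ → ℕ → ℝ} (hQ : IsSkipFree Q) {x : ℕ} {t : ℝ} {ω : Sample} (h0 : 0 ≤ t)
    (h : t < hold Q x (ω 0).1) :
    position Q x t ω = some x := by
  have h1 := lt_jumpTime_one hQ h0 h
  have hex : ∃ n, ENNReal.ofReal t < jumpTime Q x ω (n + 1) := ⟨0, h1⟩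
  rw [position, dif_pos hex, (Nat.find_eq_zero hex).2 h1]
  rfl

/-- After the first jump the path is the path of the shifted sample started from the target of the
jump. -/
lemma position_of_ge {Q : ℕ → ℕ → ℝ} (hQ : IsSkipFree Q) {x : ℕ} {t : ℝ} {ω : Sample}
    (h : hold Q x (ω 0).1 ≤ t) :
    position Q x t ω = position Q ((ω 0).2 x) (t - hold Q x (ω 0).1) (shift ω) := by
  have key := fun n => lt_jumpTime_succ_iff hQ (x := x) (ω := ω) n h
  have hz : ¬ ENNReal.ofReal t < jumpTime Q x ω (0 + 1) := by
    rw [key]; simp [jumpTime]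
  by_cases hex : ∃ n, ENNReal.ofReal (t - hold Q x (ω 0).1) <
      jumpTime Q ((ω 0).2 x) (shift ω) (n + 1)
  · have hex2 : ∃ n, ENNReal.ofReal t < jumpTime Q x ω (n + 1 + 1) :=
      hex.imp fun n hn => (key _).2 hn
    have hex1 : ∃ n, ENNReal.ofReal t < jumpTime Q x ω (n + 1) :=
      let ⟨n, hn⟩ := hex2; ⟨n + 1, hn⟩
    rw [position, position, dif_pos hex1, dif_pos hex, Nat.find_comp_succ hex1 hex2 hz,
      jumpChain_succ]
    congr 3
    funext n
    exact propext (key _)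
  · have hex1 : ¬ ∃ n, ENNReal.ofReal t < jumpTime Q x ω (n + 1) := by
      rintro ⟨n, hn⟩
      cases n with
      | zero => exact hz hn
      | succ n => exact hex ⟨n, (key _).1 hn⟩
    rw [position, position, dif_neg hex1, dif_neg hex]

lemma valueAt_of_lt {Q : ℕ → ℕ → ℝ} (hQ : IsSkipFree Q) (g : ℕ → ℝ) {x : ℕ} {t : ℝ} {ω : Sample}
    (h0 : 0 ≤ t)
    (h : t < hold Q x (ω 0).1) : valueAt Q g x t ω = g x := by
  rw [valueAt, position_of_lt hQ h0 h]; rfl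

lemma valueAt_of_ge {Q : ℕ → ℕ → ℝ} (hQ : IsSkipFree Q) (g : ℕ → ℝ) {x : ℕ} {t : ℝ} {ω : Sample}
    (h : hold Q x (ω 0).1 ≤ t) :
    valueAt Q g x t ω = valueAt Q g ((ω 0).2 x) (t - hold Q x (ω 0).1) (shift ω) := by
  rw [valueAt, position_of_ge hQ h]; rfl

/-- The Feynman-Kac variable on the event that fewer than `n` jumps occur up to time `t`, and `0`
elsewhere, defined by recursion over the first jump. -/
noncomputable def truncFK (Q : ℕ → ℕ → ℝ) (V g : ℕ → ℝ) : ℕ → ℝ → ℕ → Sample → ℝ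
  | 0, _, _, _ => 0
  | n + 1, t, x, ω =>
    if t < hold Q x (ω 0).1 then g x * Real.exp (-(V x * t))
    else Real.exp (-(V x * hold Q x (ω 0).1)) *
      truncFK Q V g n (t - hold Q x (ω 0).1) ((ω 0).2 x) (shift ω)

lemma truncFK_of_le {Q : ℕ → ℕ → ℝ} (hQ : IsSkipFree Q) (V g : ℕ → ℝ) (n : ℕ) {x : ℕ} {t : ℝ}
    {ω : Sample} (h0 : 0 ≤ t)
    (h : ¬ ENNReal.ofReal t < jumpTime Q x ω n) : truncFK Q V g n t x ω = 0 := by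
  induction n generalizing x t ω with
  | zero => rfl
  | succ n ih =>
    have hs : ¬ t < hold Q x (ω 0).1 := fun hs =>
      h ((lt_jumpTime_one hQ h0 hs).trans_le (jumpTime_mono x ω (by omega)))
    rw [truncFK, if_neg hs,
      ih (by linarith) (by rwa [lt_jumpTime_succ_iff hQ n (not_lt.1 hs)] at h),
      mul_zero]

/-- On the event of fewer than `n` jumps the potential is interval integrable along the path, so the
integral in the Feynman-Kac weight splits at the first jump. -/
lemma feynmanKacVar_of_lt {Q : ℕ → ℕ → ℝ} (hQ : IsSkipFree Q) (V g : ℕ → ℝ) (n : ℕ) {x : ℕ} {t : ℝ}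
    {ω : Sample} (h0 : 0 ≤ t)
    (h : ENNReal.ofReal t < jumpTime Q x ω n) :
    IntervalIntegrable (fun s => valueAt Q V x s ω) volume 0 t ∧
      feynmanKacVar Q V t g x ω = truncFK Q V g n t x ω := by
  induction n generalizing x t ω with
  | zero => simp [jumpTime] at h
  | succ n ih =>
    set s := hold Q x (ω 0).1 with hs
    have hs0 : 0 ≤ s := hold_nonneg hQ x _
    rw [truncFK]
    by_cases hts : t < s
    · rw [if_pos hts]
      have hc : ∀ r ∈ Set.uIcc 0 t, valueAt Q V x r ω = V x := by
        intro r hr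
        rw [Set.uIcc_of_le h0] at hr
        exact valueAt_of_lt hQ V hr.1 (hr.2.trans_lt hts)
      refine ⟨?_, ?_⟩
      · exact ((intervalIntegrable_const_iff).2 (by simp)).congr_uIoo
          (fun r hr => (hc r (Set.uIoo_subset_uIcc_self hr)).symm)
      · rw [feynmanKacVar, intervalIntegral.integral_congr (g := fun _ => V x) hc,
          valueAt_of_lt hQ g h0 hts, intervalIntegral.integral_const, smul_eq_mul]
        congr 3; ring
    · have hst := not_lt.1 hts
      rw [if_neg hts]
      obtain ⟨hi, he⟩ := ih (by linarith) ((lt_jumpTime_succ_iff hQ n hst).1 h)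
      have hc1 : ∀ r ∈ Set.Ioo 0 s, V x = valueAt Q V x r ω :=
        fun r hr => (valueAt_of_lt hQ V hr.1.le hr.2).symm
      have hc2 : ∀ r ∈ Set.uIcc s t,
          valueAt Q V ((ω 0).2 x) (r - s) (shift ω) = valueAt Q V x r ω := by
        intro r hr
        rw [Set.uIcc_of_le hst] at hr
        exact (valueAt_of_ge hQ V hr.1).symm
      have hi1 : IntervalIntegrable (fun r => valueAt Q V x r ω) volume 0 s := by
        refine ((intervalIntegrable_const_iff (c := V x)).2 (by simp)).congr_uIoo ?_
        rwa [Set.uIoo_of_le hs0]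
      have hi2 : IntervalIntegrable (fun r => valueAt Q V x r ω) volume s t := by
        have := hi.comp_sub_right s
        simp only [← hs, zero_add, sub_add_cancel] at this
        exact this.congr_uIoo fun r hr => hc2 r (Set.uIoo_subset_uIcc_self hr)
      refine ⟨hi1.trans hi2, ?_⟩
      have e1 : ∫ r in (0 : ℝ)..s, valueAt Q V x r ω = V x * s := by
        rw [← intervalIntegral.integral_congr_uIoo (f := fun _ => V x)
          (by rwa [Set.uIoo_of_le hs0]), intervalIntegral.integral_const, smul_eq_mul]
        ring
      have e2 : ∫ r in s..t, valueAt Q V x r ω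
          = ∫ r in (0 : ℝ)..(t - s), valueAt Q V ((ω 0).2 x) r (shift ω) := by
        rw [← intervalIntegral.integral_congr hc2,
          intervalIntegral.integral_comp_sub_right
            (fun r => valueAt Q V ((ω 0).2 x) r (shift ω)) s, sub_self]
      rw [← he, feynmanKacVar, feynmanKacVar,
        ← intervalIntegral.integral_add_adjacent_intervals hi1 hi2, e1, e2,
        valueAt_of_ge hQ g hst, neg_add, Real.exp_add]
      ring

lemma feynmanKacVar_of_explosion {Q : ℕ → ℕ → ℝ} (V g : ℕ → ℝ) {x : ℕ} {t : ℝ} {ω : Sample}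
    (h : ∀ n, ¬ ENNReal.ofReal t < jumpTime Q x ω n) : feynmanKacVar Q V t g x ω = 0 := by
  have hp : position Q x t ω = none := by
    rw [position, dif_neg]
    rintro ⟨n, hn⟩
    exact h _ hn
  rw [feynmanKacVar, valueAt, hp]
  simp

lemma tendsto_truncFK {Q : ℕ → ℕ → ℝ} (hQ : IsSkipFree Q) (V g : ℕ → ℝ) (x : ℕ) {t : ℝ}
    (ω : Sample) (h0 : 0 ≤ t) :
    Filter.Tendsto (fun n => truncFK Q V g n t x ω) Filter.atTop
      (nhds (feynmanKacVar Q V t g x ω)) := by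
  by_cases h : ∃ n, ENNReal.ofReal t < jumpTime Q x ω n
  · obtain ⟨n, hn⟩ := h
    refine tendsto_const_nhds.congr' ?_
    filter_upwards [Filter.eventually_ge_atTop n] with m hm
    exact (feynmanKacVar_of_lt hQ V g m h0 (hn.trans_le (jumpTime_mono x ω hm))).2
  · push Not at h
    rw [feynmanKacVar_of_explosion V g (fun n => not_lt.2 (h n))]
    refine tendsto_const_nhds.congr fun n => ?_
    rw [truncFK_of_le hQ V g n h0 (not_lt.2 (h n))]

lemma truncFK_monotone {Q : ℕ → ℕ → ℝ} (hQ : IsSkipFree Q) (V : ℕ → ℝ) {g : ℕ → ℝ}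
    (hg : ∀ y, 0 ≤ g y) (x : ℕ) {t : ℝ} (ω : Sample)
    (h0 : 0 ≤ t) : Monotone fun n => truncFK Q V g n t x ω := by
  have hnn : ∀ n x t ω, 0 ≤ truncFK Q V g n t x ω := by
    intro n
    induction n with
    | zero => intros; exact le_rfl
    | succ n ih =>
      intro x t ω
      rw [truncFK]
      split_ifs
      · exact mul_nonneg (hg x) (Real.exp_pos _).le
      · exact mul_nonneg (Real.exp_pos _).le (ih _ _ _)
  intro m n hmn
  by_cases h : ENNReal.ofReal t < jumpTime Q x ω m
  · have h1 := (feynmanKacVar_of_lt hQ V g m h0 h).2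
    have h2 := (feynmanKacVar_of_lt hQ V g n h0 (h.trans_le (jumpTime_mono x ω hmn))).2
    exact (h1.symm.trans h2).le
  · exact (truncFK_of_le hQ V g m h0 h).trans_le (hnn n x t ω)

lemma measurable_truncFK (Q : ℕ → ℕ → ℝ) (V g : ℕ → ℝ) (n x : ℕ) :
    Measurable fun p : ℝ × Sample => truncFK Q V g n p.1 x p.2 := by
  induction n generalizing x with
  | zero => exact measurable_const
  | succ n ih =>
    have hh : Measurable fun p : ℝ × Sample => hold Q x (p.2 0).1 := by
      unfold hold; fun_prop
    have hS : Measurable (shift) := by unfold shift; fun_prop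
    have hJ : Measurable fun p : ℝ × Sample => (p.2 0).2 x := by fun_prop
    have hF : Measurable fun q : (ℝ × Sample) × ℕ => truncFK Q V g n q.1.1 q.2 q.1.2 :=
      measurable_from_prod_countable_left fun y => ih y
    refine Measurable.ite (measurableSet_lt measurable_fst hh) (by fun_prop) ?_
    refine Measurable.mul (by fun_prop) ?_
    exact hF.comp (((measurable_fst.sub hh).prodMk (hS.comp measurable_snd)).prodMk hJ)

lemma IsSkipFree.measurable_feynmanKacVar {Q : ℕ → ℕ → ℝ} (hQ : IsSkipFree Q) (V g : ℕ → ℝ) {t : ℝ}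
    (ht : 0 ≤ t) (x : ℕ) : Measurable (feynmanKacVar Q V t g x) :=
  measurable_of_tendsto_metrizable
    (fun n => (measurable_truncFK Q V g n x).comp (measurable_const.prodMk measurable_id))
    (tendsto_pi_nhds.2 fun ω => tendsto_truncFK hQ V g x ω ht)

/-! ### The first-jump integral equation -/

/-- The law of one step of the sample. -/
noncomputable def stepLaw (Q : ℕ → ℕ → ℝ) : Measure (ℝ × (ℕ → ℕ)) :=
  (expMeasure 1).prod (Measure.infinitePi fun y : ℕ => (jumpLaw Q y).toMeasure)

instance : IsProbabilityMeasure (expMeasure 1) := isProbabilityMeasure_expMeasure one_pos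

instance (Q : ℕ → ℕ → ℝ) : IsProbabilityMeasure (stepLaw Q) := by unfold stepLaw; infer_instance

instance (Q : ℕ → ℕ → ℝ) : IsProbabilityMeasure (sampleLaw Q) := by
  change IsProbabilityMeasure (Measure.infinitePi fun _ : ℕ => stepLaw Q); infer_instance

/-- The sample with first step `a` and further steps `ω`. -/
def consStep (a : ℝ × (ℕ → ℕ)) (ω : Sample) : Sample
  | 0 => a
  | k + 1 => ω k

lemma measurable_consStep : Measurable fun p : (ℝ × (ℕ → ℕ)) × Sample => consStep p.1 p.2 := by
  refine measurable_pi_lambda _ fun k => ?_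
  cases k with
  | zero => exact measurable_fst
  | succ k => exact (measurable_pi_apply k).comp measurable_snd

/-- The first step of the sample is independent of the remaining ones, which have the law of the
whole sample. -/
lemma map_consStep (Q : ℕ → ℕ → ℝ) :
    ((stepLaw Q).prod (sampleLaw Q)).map (fun p => consStep p.1 p.2) = sampleLaw Q := by
  change _ = Measure.infinitePi fun _ : ℕ => stepLaw Q
  refine Measure.eq_infinitePi _ fun s A hA => ?_
  classical
  obtain ⟨n, hn⟩ : ∃ n, s ⊆ Finset.range (n + 1) :=
    ⟨s.sup id, fun k hk => Finset.mem_range.2 (Nat.lt_succ_of_le (Finset.le_sup (f := id) hk))⟩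
  -- The box may be assumed to constrain the coordinates `0, …, n`.
  set B : ℕ → Set (ℝ × (ℕ → ℕ)) := fun k => if k ∈ s then A k else Set.univ with hB
  have hBm : ∀ k, MeasurableSet (B k) := by
    intro k; simp only [hB]; split_ifs with h
    · exact hA k
    · exact MeasurableSet.univ
  have e1 : Set.pi (s : Set ℕ) A = Set.pi (Finset.range (n + 1) : Set ℕ) B := by
    ext ω
    simp only [Set.mem_pi, hB]
    refine ⟨fun h k _ => ?_, fun h k hk => ?_⟩
    · split_ifs with hk
      · exact h k hk
      · trivial
    · have := h k (hn hk)
      rwa [if_pos (by simpa using hk)] at this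
  have e2 : ∏ k ∈ s, stepLaw Q (A k) = ∏ k ∈ Finset.range (n + 1), stepLaw Q (B k) := by
    rw [← Finset.prod_subset hn]
    · refine Finset.prod_congr rfl fun k hk => ?_
      simp [hB, hk]
    · intro k _ hk
      simp [hB, hk]
  rw [e1, e2, Measure.map_apply measurable_consStep
    (MeasurableSet.pi (Finset.countable_toSet _) fun k _ => hBm k)]
  have e3 : (fun p : (ℝ × (ℕ → ℕ)) × Sample => consStep p.1 p.2) ⁻¹'
      Set.pi (Finset.range (n + 1) : Set ℕ) B
      = B 0 ×ˢ Set.pi (Finset.range n : Set ℕ) fun k => B (k + 1) := by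
    ext ⟨a, ω⟩
    simp only [Set.mem_preimage, Set.mem_pi, Set.mem_prod, Finset.coe_range, Set.mem_Iio]
    refine ⟨fun h => ⟨h 0 (by omega), fun k hk => h (k + 1) (by omega)⟩, fun h k hk => ?_⟩
    cases k with
    | zero => exact h.1
    | succ k => exact h.2 k (by omega)
  rw [e3, Measure.prod_prod, Finset.prod_range_succ', mul_comm]
  congr 1
  exact Measure.infinitePi_pi (fun _ : ℕ => stepLaw Q) fun k _ => hBm (k + 1)

lemma lintegral_sampleLaw (Q : ℕ → ℕ → ℝ) {F : Sample → ℝ≥0∞} (hF : Measurable F) :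
    ∫⁻ ω, F ω ∂(sampleLaw Q) = ∫⁻ a, ∫⁻ ω, F (consStep a ω) ∂(sampleLaw Q) ∂(stepLaw Q) := by
  conv_lhs => rw [← map_consStep Q]
  rw [lintegral_map hF measurable_consStep,
    lintegral_prod (fun p : (ℝ × (ℕ → ℕ)) × Sample => F (consStep p.1 p.2))
      (hF.comp measurable_consStep).aemeasurable]

/-- Integration of a function of the exponential variable and of the target of the jump
from `x`. -/
lemma IsSkipFree.lintegral_stepLaw {Q : ℕ → ℕ → ℝ} (hQ : IsSkipFree Q) (x : ℕ) {F : ℝ → ℕ → ℝ≥0∞}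
    (hF : ∀ y, Measurable fun e => F e y) :
    ∫⁻ a, F a.1 (a.2 x) ∂(stepLaw Q) =
      ∫⁻ e, ∑ y ∈ Finset.range (x + 2), ENNReal.ofReal (Q x y / totalRate Q x) * F e y
        ∂(expMeasure 1) := by
  have hF' : Measurable fun p : ℝ × ℕ => F p.1 p.2 := measurable_from_prod_countable_left hF
  rw [stepLaw, lintegral_prod]
  swap
  · exact (hF'.comp (measurable_fst.prodMk
      ((measurable_pi_apply x).comp measurable_snd))).aemeasurable
  refine lintegral_congr fun e => ?_
  have h1 := measurePreserving_eval_infinitePi (fun y : ℕ => (jumpLaw Q y).toMeasure) x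
  have h2 := h1.lintegral_comp (f := F e) (measurable_of_countable _)
  simp only [Function.eval] at h2
  rw [h2, lintegral_countable']
  have h3 : ∀ y, F e y * (jumpLaw Q x).toMeasure {y}
      = ENNReal.ofReal (Q x y / totalRate Q x) * F e y := by
    intro y
    have hne : exitRate Q x ≠ 0 ∧ exitRate Q x ≠ ∞ := by
      rw [hQ.exitRate_eq]
      exact ⟨by simpa using hQ.pos x, ENNReal.ofReal_ne_top⟩
    rw [PMF.toMeasure_apply_singleton _ _ (measurableSet_singleton y), jumpLaw, dif_pos hne,
      mul_comm, ENNReal.ofReal_div_of_pos (hQ.pos x), ← hQ.exitRate_eq]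
    rfl
  simp_rw [h3]
  refine tsum_eq_sum fun y hy => ?_
  rw [hQ.skip x y (by simp at hy; omega)]
  simp

/-- The holding time in `x` is exponential with parameter `totalRate Q x`. -/
lemma lintegral_hold {Q : ℕ → ℕ → ℝ} (hQ : IsSkipFree Q) (x : ℕ) {φ : ℝ → ℝ≥0∞}
    (hφ : Measurable φ) :
    ∫⁻ e, φ (hold Q x e) ∂(expMeasure 1) =
      ∫⁻ s in Set.Ioi 0,
        ENNReal.ofReal (totalRate Q x * Real.exp (-(totalRate Q x * s))) * φ s := by
  set q := totalRate Q x with hq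
  have hq0 : 0 < q := hQ.pos x
  have hm : Measurable fun e => φ (hold Q x e) := hφ.comp (by unfold hold; fun_prop)
  have hpm : Measurable (exponentialPDF 1) := (measurable_exponentialPDFReal 1).ennreal_ofReal
  have e0 : expMeasure 1 = volume.withDensity (exponentialPDF 1) := rfl
  rw [e0, lintegral_withDensity_eq_lintegral_mul _ hpm hm]
  have e1 : ∫⁻ e, (exponentialPDF 1 * fun e => φ (hold Q x e)) e
      = ∫⁻ e in Set.Ioi 0, ENNReal.ofReal (Real.exp (-e)) * φ (e / q) := by
    rw [← lintegral_indicator measurableSet_Ioi]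
    have : ∀ᵐ e : ℝ, e ≠ 0 := by simp [ae_iff]
    refine lintegral_congr_ae ?_
    filter_upwards [this] with e he
    rcases lt_or_gt_of_ne he with h | h
    · rw [Set.indicator_of_notMem (by simpa using h.le), Pi.mul_apply, exponentialPDF_of_neg h,
        zero_mul]
    · rw [Set.indicator_of_mem (by simpa using h), Pi.mul_apply, exponentialPDF_of_nonneg h.le,
        hold, max_eq_left h.le]
      simp only [one_mul]
      rfl
  rw [e1]
  conv_lhs => rw [← Real.smul_map_volume_mul_left hq0.ne']
  rw [Measure.restrict_smul, lintegral_smul_measure,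
    setLIntegral_map measurableSet_Ioi (by fun_prop) (by fun_prop),
    abs_of_pos hq0, smul_eq_mul, ← lintegral_const_mul _ (by fun_prop)]
  have e2 : (fun s => q * s) ⁻¹' Set.Ioi 0 = Set.Ioi 0 := by
    ext s; simp [hq0]
  rw [e2]
  refine setLIntegral_congr_fun measurableSet_Ioi fun s _ => ?_
  rw [← mul_assoc, ← ENNReal.ofReal_mul hq0.le, mul_div_cancel_left₀ _ hq0.ne']

lemma lintegral_exp_tail {q : ℝ} (hq : 0 < q) (t : ℝ) :
    ∫⁻ s in Set.Ioi t, ENNReal.ofReal (q * Real.exp (-(q * s))) =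
      ENNReal.ofReal (Real.exp (-(q * t))) := by
  have hi : IntegrableOn (fun s => q * Real.exp (-(q * s))) (Set.Ioi t) := by
    have := (integrableOn_exp_mul_Ioi (a := -q) (by linarith) t).const_mul q
    simpa [neg_mul, IntegrableOn] using this
  rw [← ofReal_integral_eq_lintegral_ofReal hi (Filter.Eventually.of_forall fun s => by positivity)]
  congr 1
  rw [integral_const_mul]
  have := integral_exp_mul_Ioi (a := -q) (by linarith) t
  simp only [neg_mul] at this
  rw [this]
  field_simp

/-- The operator of the first-jump integral equation of the Feynman-Kac semigroup with rates `Q`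
and potential `V` started from `g`. -/
noncomputable def firstJump (Q : ℕ → ℕ → ℝ) (V g : ℕ → ℝ) (ψ : ℝ → ℕ → ℝ≥0∞) (t : ℝ) (x : ℕ) :
    ℝ≥0∞ :=
  ENNReal.ofReal (g x * Real.exp (-((totalRate Q x + V x) * t))) +
    ∫⁻ s in Set.Ioc 0 t, ENNReal.ofReal (Real.exp (-((totalRate Q x + V x) * s))) *
      ∑ y ∈ Finset.range (x + 2), ENNReal.ofReal (Q x y) * ψ (t - s) y

/-- Expectation of the Feynman-Kac variable on the event that fewer than `n` jumps occur. -/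
noncomputable def truncFKMean (Q : ℕ → ℕ → ℝ) (V g : ℕ → ℝ) (n : ℕ) (t : ℝ) (x : ℕ) : ℝ≥0∞ :=
  ∫⁻ ω, ENNReal.ofReal (truncFK Q V g n t x ω) ∂(sampleLaw Q)

lemma measurable_truncFKMean (Q : ℕ → ℕ → ℝ) (V g : ℕ → ℝ) (n x : ℕ) :
    Measurable fun t => truncFKMean Q V g n t x :=
  (measurable_truncFK Q V g n x).ennreal_ofReal.lintegral_prod_right'

/-- Conditioning on the first jump. -/
lemma truncFKMean_succ {Q : ℕ → ℕ → ℝ} (hQ : IsSkipFree Q) (V g : ℕ → ℝ) (n : ℕ)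
    {t : ℝ} (ht : 0 ≤ t) (x : ℕ) :
    truncFKMean Q V g (n + 1) t x = firstJump Q V g (truncFKMean Q V g n) t x := by
  have hmean := measurable_truncFKMean Q V g n
  set q := totalRate Q x with hq
  have hq0 : 0 < q := hQ.pos x
  -- The conditional expectation given the holding time `s` and the target `y` of the first jump.
  set H : ℝ → ℕ → ℝ≥0∞ := fun s y => if t < s then ENNReal.ofReal (g x * Real.exp (-(V x * t)))
    else ENNReal.ofReal (Real.exp (-(V x * s))) * truncFKMean Q V g n (t - s) y with hH
  have hHm : ∀ y, Measurable fun s => H s y := by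
    intro y
    refine Measurable.ite measurableSet_Ioi measurable_const ?_
    exact Measurable.mul (by fun_prop) ((hmean y).comp (by fun_prop))
  have hhold : Measurable (hold Q x) := by unfold hold; fun_prop
  rw [truncFKMean,
    lintegral_sampleLaw Q (F := fun ω => ENNReal.ofReal (truncFK Q V g (n + 1) t x ω))
      ((measurable_truncFK Q V g (n + 1) x).ennreal_ofReal.comp
        (measurable_const.prodMk measurable_id))]
  have e1 : ∀ a : ℝ × (ℕ → ℕ),
      ∫⁻ ω, ENNReal.ofReal (truncFK Q V g (n + 1) t x (consStep a ω)) ∂(sampleLaw Q)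
        = H (hold Q x a.1) (a.2 x) := by
    intro a
    simp only [truncFK, hH]
    change ∫⁻ ω, ENNReal.ofReal (if t < hold Q x a.1 then _ else _ * truncFK Q V g n _ (a.2 x) ω)
      ∂(sampleLaw Q) = _
    split_ifs with h
    · rw [lintegral_const, measure_univ, mul_one]
    · rw [truncFKMean, ← lintegral_const_mul]
      · refine lintegral_congr fun ω => ?_
        rw [← ENNReal.ofReal_mul (Real.exp_pos _).le]; rfl
      · exact (measurable_truncFK Q V g n (a.2 x)).ennreal_ofReal.comp
          (measurable_const.prodMk measurable_id)
  rw [lintegral_congr e1, hQ.lintegral_stepLaw x (F := fun e y => H (hold Q x e) y)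
    (fun y => (hHm y).comp hhold),
    lintegral_hold hQ x (φ := fun s => ∑ y ∈ Finset.range (x + 2),
      ENNReal.ofReal (Q x y / totalRate Q x) * H s y)
      (Finset.measurable_sum _ fun y _ => (hHm y).const_mul _),
    ← Set.Ioc_union_Ioi_eq_Ioi ht, lintegral_union measurableSet_Ioi
      (Set.disjoint_left.2 fun s hs hs' => (not_lt.2 hs.2) hs'), add_comm, firstJump]
  congr 1
  · have e2 : ∀ s ∈ Set.Ioi t, ENNReal.ofReal (totalRate Q x * Real.exp (-(totalRate Q x * s))) *
        ∑ y ∈ Finset.range (x + 2), ENNReal.ofReal (Q x y / totalRate Q x) * H s y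
        = ENNReal.ofReal (q * Real.exp (-(q * s))) *
          ENNReal.ofReal (g x * Real.exp (-(V x * t))) := by
      intro s hs
      congr 1
      simp only [hH, if_pos (Set.mem_Ioi.1 hs)]
      rw [← Finset.sum_mul, ← ENNReal.ofReal_sum_of_nonneg
        (fun y _ => div_nonneg (hQ.nonneg x y) hq0.le), ← Finset.sum_div]
      change ENNReal.ofReal (q / q) * _ = _
      rw [div_self hq0.ne', ENNReal.ofReal_one, one_mul]
    rw [setLIntegral_congr_fun measurableSet_Ioi e2, lintegral_mul_const _ (by fun_prop),
      lintegral_exp_tail hq0, ← ENNReal.ofReal_mul (Real.exp_pos _).le]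
    congr 1
    rw [mul_left_comm, ← Real.exp_add]
    congr 2; ring
  · refine setLIntegral_congr_fun measurableSet_Ioc fun s hs => ?_
    simp only [hH, if_neg (not_lt.2 hs.2)]
    rw [Finset.mul_sum, Finset.mul_sum]
    refine Finset.sum_congr rfl fun y _ => ?_
    rw [← mul_assoc, ← mul_assoc, ← mul_assoc, ← ENNReal.ofReal_mul (by positivity),
      ← ENNReal.ofReal_mul (mul_nonneg (by positivity) (div_nonneg (hQ.nonneg x y) hq0.le)),
      ← ENNReal.ofReal_mul (Real.exp_pos _).le]
    congr 2
    have : Real.exp (-((totalRate Q x + V x) * s))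
        = Real.exp (-(totalRate Q x * s)) * Real.exp (-(V x * s)) := by
      rw [← Real.exp_add]; congr 1; ring
    rw [this, ← hq]
    field_simp

/-! ### Approximation of the Feynman-Kac semigroup by finite systems -/

/-- The generator with rates `Q` and potential `V`, for rates without upward jumps of size larger
than one: `w ↦ ∑ y, Q x y * (w y - w x) - V x * w x`. -/
noncomputable def gen (Q : ℕ → ℕ → ℝ) (V : ℕ → ℝ) (w : ℕ → ℝ) (x : ℕ) : ℝ :=
  ∑ y ∈ Finset.range (x + 2), Q x y * w y - (totalRate Q x + V x) * w x

/-- The matrix of the generator with rates `Q` and potential `V`. -/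
noncomputable def genMatrix (Q : ℕ → ℕ → ℝ) (V : ℕ → ℝ) (x y : ℕ) : ℝ :=
  Q x y - if y = x then totalRate Q x + V x else 0

/-- The semigroup of the process with rates `Q` and potential `V` which is killed when it leaves
`{0, …, N - 1}`. -/
noncomputable def killedFlow (Q : ℕ → ℕ → ℝ) (V : ℕ → ℝ) (N : ℕ) (g : ℕ → ℝ) (t : ℝ) (x : ℕ) : ℝ :=
  linFlow (genMatrix Q V) N g t x

lemma sum_genMatrix_mul (Q : ℕ → ℕ → ℝ) (V w : ℕ → ℝ) {N x : ℕ} (hx : x < N) :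
    ∑ y ∈ Finset.range N, genMatrix Q V x y * w y =
      ∑ y ∈ Finset.range N, Q x y * w y - (totalRate Q x + V x) * w x := by
  simp only [genMatrix, sub_mul, Finset.sum_sub_distrib, ite_mul, zero_mul]
  rw [Finset.sum_ite_eq' (Finset.range N) x, if_pos (Finset.mem_range.2 hx)]

lemma killedFlow_of_le {Q : ℕ → ℕ → ℝ} {V : ℕ → ℝ} {N : ℕ} {g : ℕ → ℝ} {t : ℝ} {x : ℕ} (h : N ≤ x) :
    killedFlow Q V N g t x = 0 := linFlow_of_le h

lemma hasDerivAt_killedFlow (Q : ℕ → ℕ → ℝ) (V : ℕ → ℝ) (N : ℕ) (g : ℕ → ℝ) (t : ℝ) {x : ℕ}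
    (h : x < N) :
    HasDerivAt (fun s => killedFlow Q V N g s x)
      (∑ y ∈ Finset.range N, Q x y * killedFlow Q V N g t y
        - (totalRate Q x + V x) * killedFlow Q V N g t x) t := by
  rw [← sum_genMatrix_mul Q V _ h]
  exact hasDerivAt_linFlow _ N g t h

section

variable {Q : ℕ → ℕ → ℝ}

lemma IsSkipFree.sum_range_le (hQ : IsSkipFree Q) {w : ℕ → ℝ} (hw : ∀ y, 0 ≤ w y) (N x : ℕ) :
    ∑ y ∈ Finset.range N, Q x y * w y ≤ ∑ y ∈ Finset.range (x + 2), Q x y * w y := by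
  have h : ∑ y ∈ Finset.range (x + 2), Q x y * w y
      = ∑ y ∈ Finset.range (max N (x + 2)), Q x y * w y := by
    refine Finset.sum_subset (Finset.range_mono (le_max_right _ _)) fun y _ hy => ?_
    rw [hQ.skip x y (by simp at hy; omega), zero_mul]
  rw [h]
  exact Finset.sum_le_sum_of_subset_of_nonneg (Finset.range_mono (le_max_left _ _))
    fun y _ _ => mul_nonneg (hQ.nonneg x y) (hw y)

lemma IsSkipFree.sum_range_eq (hQ : IsSkipFree Q) (w : ℕ → ℝ) {N x : ℕ} (h : x + 2 ≤ N) :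
    ∑ y ∈ Finset.range N, Q x y * w y = ∑ y ∈ Finset.range (x + 2), Q x y * w y := by
  refine (Finset.sum_subset (Finset.range_mono h) fun y _ hy => ?_).symm
  rw [hQ.skip x y (by simp at hy; omega), zero_mul]

lemma genMatrix_nonneg (hQ : IsSkipFree Q) (V : ℕ → ℝ) (x y : ℕ) (h : x ≠ y) :
    0 ≤ genMatrix Q V x y := by
  rw [genMatrix, if_neg h.symm, sub_zero]
  exact hQ.nonneg x y

lemma killedFlow_nonneg (hQ : IsSkipFree Q) (V : ℕ → ℝ) (N : ℕ) {g : ℕ → ℝ} (hg : ∀ y, 0 ≤ g y)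
    {t : ℝ}
    (ht : 0 ≤ t) (x : ℕ) : 0 ≤ killedFlow Q V N g t x := by
  rcases Nat.lt_or_ge x N with hx | hx
  · refine nonneg_of_deriv_ge_matrix (genMatrix_nonneg hQ V)
      (fun t _ x hx => hasDerivAt_linFlow (genMatrix Q V) N g t hx) ?_ (fun _ _ _ _ => le_rfl) ht hx
    intro x hx
    rw [linFlow_zero hx]; exact hg x
  · exact (killedFlow_of_le hx).ge

lemma killedFlow_mono (hQ : IsSkipFree Q) (V : ℕ → ℝ) {g : ℕ → ℝ} (hg : ∀ y, 0 ≤ g y) {t : ℝ}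
    (ht : 0 ≤ t) (x : ℕ) : Monotone fun N => killedFlow Q V N g t x := by
  refine monotone_nat_of_le_succ fun N => ?_
  rcases Nat.lt_or_ge x N with hx | hx
  · rw [← sub_nonneg]
    refine nonneg_of_deriv_ge_matrix (n := N) (genMatrix_nonneg hQ V)
      (E := fun t x => killedFlow Q V (N + 1) g t x - killedFlow Q V N g t x)
      (fun t _ x hx => (hasDerivAt_linFlow (genMatrix Q V) (N + 1) g t (by omega)).sub
        (hasDerivAt_linFlow (genMatrix Q V) N g t hx)) ?_ ?_ ht hx
    · intro x hx
      simp only [killedFlow]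
      rw [linFlow_zero hx, linFlow_zero (by omega), sub_self]
    · intro t ht x hx
      rw [Finset.sum_range_succ]
      have h1 := mul_nonneg (genMatrix_nonneg hQ V x N hx.ne)
        (killedFlow_nonneg hQ V (N + 1) hg ht N)
      simp only [mul_sub, Finset.sum_sub_distrib]
      unfold killedFlow at *
      linarith
  · rw [killedFlow_of_le hx]
    exact killedFlow_nonneg hQ V _ hg ht x

/-- Supersolutions of the eigenvalue equation dominate the killed semigroups. -/
lemma killedFlow_le_of_gen_le (hQ : IsSkipFree Q) (V : ℕ → ℝ) (N : ℕ) {g ψ : ℕ → ℝ} {c : ℝ}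
    (hψ : ∀ y, 0 ≤ ψ y) (hgψ : ∀ y, g y ≤ ψ y) (hgen : ∀ x < N, gen Q V ψ x ≤ c * ψ x) {t : ℝ}
    (ht : 0 ≤ t) (x : ℕ) : killedFlow Q V N g t x ≤ Real.exp (c * t) * ψ x := by
  rcases Nat.lt_or_ge x N with hx | hx
  · rw [← sub_nonneg]
    refine nonneg_of_deriv_ge_matrix (n := N) (genMatrix_nonneg hQ V)
      (E := fun t x => Real.exp (c * t) * ψ x - killedFlow Q V N g t x)
      (fun t _ x hx => ((((hasDerivAt_id t).const_mul c).exp.mul_const (ψ x)).sub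
        (hasDerivAt_linFlow (genMatrix Q V) N g t hx))) ?_ ?_ ht hx
    · intro x hx
      simp only [killedFlow]
      rw [linFlow_zero hx]
      simpa using hgψ x
    · intro t ht x hx
      simp only [mul_sub, Finset.sum_sub_distrib, id, mul_one]
      refine sub_le_sub_right ?_ _
      simp only [mul_left_comm _ (Real.exp _), ← Finset.mul_sum]
      rw [mul_assoc]
      refine mul_le_mul_of_nonneg_left ?_ (Real.exp_pos _).le
      rw [sum_genMatrix_mul _ _ _ hx]
      have h1 := hQ.sum_range_le hψ N x
      have h2 := hgen x hx
      unfold gen at h2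
      linarith
  · rw [killedFlow_of_le hx]
    exact mul_nonneg (Real.exp_pos _).le (hψ x)

lemma measurable_killedFlow (Q : ℕ → ℕ → ℝ) (V : ℕ → ℝ) (N : ℕ) (g : ℕ → ℝ) (x : ℕ) :
    Measurable fun t => killedFlow Q V N g t x := by
  rcases Nat.lt_or_ge x N with hx | hx
  · exact (continuous_iff_continuousAt.2
      fun t => (hasDerivAt_killedFlow Q V N g t hx).continuousAt).measurable
  · simp only [killedFlow_of_le hx]; exact measurable_const

/-- The killed semigroup solves the first-jump integral equation of the killed process: variation of
constants. -/
lemma killedFlow_eq_lintegral (hQ : IsSkipFree Q) (V : ℕ → ℝ) (N : ℕ) {g : ℕ → ℝ}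
    (hg : ∀ y, 0 ≤ g y)
    {t : ℝ} (ht : 0 ≤ t) {x : ℕ} (hx : x < N) :
    ENNReal.ofReal (killedFlow Q V N g t x) =
      ENNReal.ofReal (g x * Real.exp (-((totalRate Q x + V x) * t))) +
        ∫⁻ s in Set.Ioc 0 t, ENNReal.ofReal (Real.exp (-((totalRate Q x + V x) * s)) *
          ∑ y ∈ Finset.range N, Q x y * killedFlow Q V N g (t - s) y) := by
  set c := totalRate Q x + V x with hc
  set w := killedFlow Q V N g with hw
  have hcont : ∀ y ∈ Finset.range N, Continuous fun s => w s y := fun y hy =>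
    continuous_iff_continuousAt.2
      fun t => (hasDerivAt_killedFlow Q V N g t (Finset.mem_range.1 hy)).continuousAt
  have hcontF : Continuous fun s => Real.exp (-(c * s)) *
      ∑ y ∈ Finset.range N, Q x y * w (t - s) y := by
    refine Continuous.mul (by fun_prop) (continuous_finsetSum _ fun y hy => ?_)
    exact continuous_const.mul ((hcont y hy).comp (by fun_prop))
  have hd : ∀ s : ℝ, HasDerivAt (fun s => -(Real.exp (-(c * s)) * w (t - s) x))
      (Real.exp (-(c * s)) * ∑ y ∈ Finset.range N, Q x y * w (t - s) y) s := by
    intro s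
    have h1 : HasDerivAt (fun s => Real.exp (-(c * s))) (Real.exp (-(c * s)) * (-(c * 1))) s :=
      ((hasDerivAt_id s).const_mul c).neg.exp
    have h2 : HasDerivAt (fun s => t - s) (-1) s := (hasDerivAt_id s).const_sub t
    have h3 := (hasDerivAt_killedFlow Q V N g (t - s) hx).comp s h2
    refine (h1.mul h3).neg.congr_deriv ?_
    simp only [Function.comp, ← hw, ← hc]
    ring
  have hint : ∫ s in (0 : ℝ)..t, Real.exp (-(c * s)) * ∑ y ∈ Finset.range N, Q x y * w (t - s) y
      = w t x - g x * Real.exp (-(c * t)) := by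
    rw [intervalIntegral.integral_eq_sub_of_hasDerivAt (fun s _ => hd s)
      (hcontF.intervalIntegrable _ _)]
    have : w 0 x = g x := linFlow_zero hx
    simp only [sub_self, this, mul_zero, neg_zero, Real.exp_zero, sub_zero]
    ring
  have hnn : ∀ s ∈ Set.Ioc 0 t, 0 ≤ Real.exp (-(c * s)) *
      ∑ y ∈ Finset.range N, Q x y * w (t - s) y := fun s hs =>
    mul_nonneg (Real.exp_pos _).le (Finset.sum_nonneg fun y _ =>
      mul_nonneg (hQ.nonneg x y) (killedFlow_nonneg hQ V N hg (by linarith [hs.2]) y))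
  rw [← ofReal_integral_eq_lintegral_ofReal
    ((hcontF.intervalIntegrable 0 t).1) ((ae_restrict_iff' measurableSet_Ioc).2
      (Filter.Eventually.of_forall hnn)), ← intervalIntegral.integral_of_le ht, hint,
    ← ENNReal.ofReal_add (mul_nonneg (hg x) (Real.exp_pos _).le)]
  · congr 1; ring
  · rw [← hint, intervalIntegral.integral_of_le ht]
    exact setIntegral_nonneg measurableSet_Ioc hnn

lemma ofReal_exp_mul_sum (hQ : IsSkipFree Q) (c : ℝ) (x : ℕ) {w : ℕ → ℝ} (hw : ∀ y, 0 ≤ w y) :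
    ENNReal.ofReal (Real.exp c * ∑ y ∈ Finset.range (x + 2), Q x y * w y) =
      ENNReal.ofReal (Real.exp c) *
        ∑ y ∈ Finset.range (x + 2), ENNReal.ofReal (Q x y) * ENNReal.ofReal (w y) := by
  rw [ENNReal.ofReal_mul (Real.exp_pos _).le,
    ENNReal.ofReal_sum_of_nonneg fun y _ => mul_nonneg (hQ.nonneg x y) (hw y)]
  congr 1
  exact Finset.sum_congr rfl fun y _ => ENNReal.ofReal_mul (hQ.nonneg x y)

lemma killedFlow_le_firstJump (hQ : IsSkipFree Q) (V : ℕ → ℝ) (N : ℕ) {g : ℕ → ℝ}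
    (hg : ∀ y, 0 ≤ g y)
    {t : ℝ} (ht : 0 ≤ t) {x : ℕ} (hx : x < N) :
    ENNReal.ofReal (killedFlow Q V N g t x) ≤
      firstJump Q V g (fun s y => ENNReal.ofReal (killedFlow Q V N g s y)) t x := by
  rw [killedFlow_eq_lintegral hQ V N hg ht hx, firstJump]
  gcongr ?_ + ?_
  · exact le_rfl
  refine setLIntegral_mono' measurableSet_Ioc fun s hs => ?_
  have hnn := killedFlow_nonneg hQ V N hg (t := t - s) (by linarith [hs.2])
  rw [← ofReal_exp_mul_sum hQ _ x hnn]
  exact ENNReal.ofReal_le_ofReal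
    (mul_le_mul_of_nonneg_left (hQ.sum_range_le hnn N x) (Real.exp_pos _).le)

lemma killedFlow_eq_firstJump (hQ : IsSkipFree Q) (V : ℕ → ℝ) {N : ℕ} {g : ℕ → ℝ}
    (hg : ∀ y, 0 ≤ g y)
    {t : ℝ} (ht : 0 ≤ t) {x : ℕ} (hx : x + 2 ≤ N) :
    ENNReal.ofReal (killedFlow Q V N g t x) =
      firstJump Q V g (fun s y => ENNReal.ofReal (killedFlow Q V N g s y)) t x := by
  rw [killedFlow_eq_lintegral hQ V N hg ht (by omega), firstJump]
  congr 1
  refine setLIntegral_congr_fun measurableSet_Ioc fun s hs => ?_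
  have hnn := killedFlow_nonneg hQ V N hg (t := t - s) (by linarith [hs.2])
  rw [← ofReal_exp_mul_sum hQ _ x hnn, hQ.sum_range_eq _ hx]

lemma firstJump_mono (Q : ℕ → ℕ → ℝ) (V g : ℕ → ℝ) {ψ φ : ℝ → ℕ → ℝ≥0∞} {t : ℝ}
    (h : ∀ s, 0 ≤ s → ∀ y, ψ s y ≤ φ s y) (x : ℕ) :
    firstJump Q V g ψ t x ≤ firstJump Q V g φ t x := by
  unfold firstJump
  gcongr ?_ + ?_
  · exact le_rfl
  refine setLIntegral_mono' measurableSet_Ioc fun s hs => ?_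
  gcongr with y hy
  exact h _ (by linarith [hs.2]) y

/-- The limit of the killed semigroups solves the first-jump integral equation. -/
lemma firstJump_iSup_killedFlow_le (hQ : IsSkipFree Q) (V : ℕ → ℝ) {g : ℕ → ℝ} (hg : ∀ y, 0 ≤ g y)
    {t : ℝ} (ht : 0 ≤ t) (x : ℕ) :
    firstJump Q V g (fun s y => ⨆ N, ENNReal.ofReal (killedFlow Q V N g s y)) t x ≤
      ⨆ N, ENNReal.ofReal (killedFlow Q V N g t x) := by
  have hmono : ∀ s, 0 ≤ s → ∀ y, Monotone fun N => ENNReal.ofReal (killedFlow Q V N g s y) :=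
    fun s hs y N M h => ENNReal.ofReal_le_ofReal (killedFlow_mono hQ V hg hs y h)
  have h1 : firstJump Q V g (fun s y => ⨆ N, ENNReal.ofReal (killedFlow Q V N g s y)) t x
      = ⨆ N, firstJump Q V g (fun s y => ENNReal.ofReal (killedFlow Q V N g s y)) t x := by
    simp only [firstJump]
    rw [← ENNReal.add_iSup, ← lintegral_iSup']
    · congr 1
      refine setLIntegral_congr_fun measurableSet_Ioc fun s hs => ?_
      rw [← ENNReal.mul_iSup, ← ENNReal.finsetSum_iSup_of_monotone]
      · simp only [ENNReal.mul_iSup]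
      · intro y N M h
        have := hmono (t - s) (by linarith [hs.2]) y h
        simp only at this ⊢
        gcongr
    · intro N
      refine (Measurable.mul (by fun_prop) (Finset.measurable_sum _ fun y _ => ?_)).aemeasurable
      exact (((measurable_killedFlow Q V N g y).comp (by fun_prop)).ennreal_ofReal).const_mul _
    · refine (ae_restrict_iff' measurableSet_Ioc).2 (Filter.Eventually.of_forall fun s hs => ?_)
      intro N M h
      simp only
      gcongr with y hy
      exact killedFlow_mono hQ V hg (by linarith [hs.2]) y h
  rw [h1]
  refine iSup_le fun N => ?_
  refine le_trans ?_ (le_iSup _ (max N (x + 2)))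
  rw [killedFlow_eq_firstJump hQ V hg ht (le_max_right _ _)]
  exact firstJump_mono Q V g (fun s hs y => hmono s hs y (le_max_left _ _)) x

lemma truncFKMean_le_iSup_killedFlow (hQ : IsSkipFree Q) (V : ℕ → ℝ) {g : ℕ → ℝ} (hg : ∀ y, 0 ≤ g y)
    (n : ℕ) {t : ℝ} (ht : 0 ≤ t) (x : ℕ) :
    truncFKMean Q V g n t x ≤ ⨆ N, ENNReal.ofReal (killedFlow Q V N g t x) := by
  induction n generalizing t x with
  | zero => simp [truncFKMean, truncFK]
  | succ n ih =>
    rw [truncFKMean_succ hQ V g n ht x]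
    exact (firstJump_mono Q V g (fun s hs y => ih hs y) x).trans
      (firstJump_iSup_killedFlow_le hQ V hg ht x)

/-- On `{0, …, N - 1}` the first-jump equation is a contraction in a weighted norm, so the killed
semigroup is below its iterates up to a geometrically small error. -/
lemma exists_killedFlow_le_truncFKMean_add (hQ : IsSkipFree Q) (V : ℕ → ℝ) (N : ℕ) {g : ℕ → ℝ}
    (hg : ∀ y, 0 ≤ g y) :
    ∃ M c : ℝ, 0 ≤ M ∧ ∀ (n : ℕ) (t : ℝ), 0 ≤ t → ∀ x,
      ENNReal.ofReal (killedFlow Q V N g t x) ≤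
        truncFKMean Q V g n t x + ENNReal.ofReal (M * Real.exp (c * t) * (1 / 2) ^ n) := by
  set M := ∑ y ∈ Finset.range N, g y with hM
  set c := ∑ y ∈ Finset.range N, (totalRate Q y + |V y|) with hc
  have hM0 : 0 ≤ M := Finset.sum_nonneg fun y _ => hg y
  have hcx : ∀ x < N, totalRate Q x + |V x| ≤ c := fun x hx =>
    Finset.single_le_sum (f := fun y => totalRate Q y + |V y|)
      (fun y _ => add_nonneg (hQ.pos y).le (abs_nonneg _)) (Finset.mem_range.2 hx)
  refine ⟨M, c, hM0, fun n => ?_⟩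
  induction n with
  | zero =>
    intro t ht x
    refine le_trans (ENNReal.ofReal_le_ofReal ?_) le_add_self
    rw [pow_zero, mul_one, mul_comm]
    have hle : ∀ y, (if y < N then g y else 0) ≤ M := by
      intro y
      split_ifs with h
      · exact Finset.single_le_sum (fun y _ => hg y) (Finset.mem_range.2 h)
      · exact hM0
    have heq : killedFlow Q V N g t x =
        killedFlow Q V N (fun y => if y < N then g y else 0) t x := by
      simp only [killedFlow, linFlow, Fin.is_lt, if_true]
    rw [heq]
    refine killedFlow_le_of_gen_le hQ V N (ψ := fun _ => M) (fun _ => hM0) hle ?_ ht x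
    intro x hx
    rw [gen, ← Finset.sum_mul]
    change totalRate Q x * M - _ ≤ _
    have h1 := hcx x hx
    have h2 := neg_abs_le (V x)
    have h3 := hQ.pos x
    nlinarith
  | succ n ih =>
    intro t ht x
    rcases Nat.lt_or_ge x N with hx | hx
    swap
    · simp [killedFlow_of_le hx]
    set q := totalRate Q x with hq
    have hq0 : 0 < q := hQ.pos x
    refine (killedFlow_le_firstJump hQ V N hg ht hx).trans ?_
    refine (firstJump_mono Q V g (fun s hs y => ih s hs y) x).trans ?_
    rw [truncFKMean_succ hQ V g n ht x]
    simp only [firstJump, mul_add, Finset.sum_add_distrib]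
    rw [lintegral_add_left, ← add_assoc]
    swap
    · refine Measurable.mul (by fun_prop) (Finset.measurable_sum _ fun y _ => ?_)
      exact ((measurable_truncFKMean Q V g n y).comp (by fun_prop)).const_mul _
    gcongr ?_ + ?_
    · exact le_rfl
    have hbound : ∀ s ∈ Set.Ioc 0 t, ENNReal.ofReal (Real.exp (-((q + V x) * s))) *
        ∑ y ∈ Finset.range (x + 2), ENNReal.ofReal (Q x y) *
          ENNReal.ofReal (M * Real.exp (c * (t - s)) * (1 / 2) ^ n)
        ≤ ENNReal.ofReal (M * Real.exp (c * t) * (1 / 2) ^ (n + 1)) *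
          ENNReal.ofReal (2 * q * Real.exp (-(2 * q * s))) := by
      intro s hs
      rw [← ofReal_exp_mul_sum hQ _ x
        (w := fun _ => M * Real.exp (c * (t - s)) * (1 / 2) ^ n) (fun _ => by positivity),
        ← Finset.sum_mul, ← ENNReal.ofReal_mul (by positivity)]
      refine ENNReal.ofReal_le_ofReal ?_
      change Real.exp _ * (q * _) ≤ _
      have h1 : Real.exp (-((q + V x) * s)) * Real.exp (c * (t - s))
          ≤ Real.exp (c * t) * Real.exp (-(2 * q * s)) := by
        rw [← Real.exp_add, ← Real.exp_add]
        refine Real.exp_le_exp.2 ?_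
        have h2 := hcx x hx
        have h3 := neg_abs_le (V x)
        have h4 := hs.1.le
        nlinarith
      calc _ = (Real.exp (-((q + V x) * s)) * Real.exp (c * (t - s))) * (q * M * (1 / 2) ^ n) := by
            ring
        _ ≤ (Real.exp (c * t) * Real.exp (-(2 * q * s))) * (q * M * (1 / 2) ^ n) := by gcongr
        _ = _ := by ring
    refine (setLIntegral_mono' measurableSet_Ioc hbound).trans ?_
    rw [lintegral_const_mul _ (by fun_prop)]
    have h5 : ∫⁻ s in Set.Ioc 0 t, ENNReal.ofReal (2 * q * Real.exp (-(2 * q * s))) ≤ 1 := by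
      refine (lintegral_mono_set Set.Ioc_subset_Ioi_self).trans ?_
      rw [lintegral_exp_tail (by positivity)]
      simp
    exact (mul_le_mul_right h5 _).trans (mul_one _).le

/-- The Feynman-Kac semigroup of a nonnegative function is the limit of the semigroups killed
outside of `{0, …, N - 1}`. -/
theorem lintegral_feynmanKacVar (hQ : IsSkipFree Q) (V : ℕ → ℝ) {g : ℕ → ℝ} (hg : ∀ y, 0 ≤ g y)
    {t : ℝ} (ht : 0 ≤ t) (x : ℕ) :
    ∫⁻ ω, ENNReal.ofReal (feynmanKacVar Q V t g x ω) ∂(sampleLaw Q) =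
      ⨆ N, ENNReal.ofReal (killedFlow Q V N g t x) := by
  have hlim : Filter.Tendsto (fun n => truncFKMean Q V g n t x) Filter.atTop
      (nhds (∫⁻ ω, ENNReal.ofReal (feynmanKacVar Q V t g x ω) ∂(sampleLaw Q))) := by
    refine lintegral_tendsto_of_tendsto_of_monotone (fun n => ?_) ?_ ?_
    · exact ((measurable_truncFK Q V g n x).ennreal_ofReal.comp
        (measurable_const.prodMk measurable_id)).aemeasurable
    · exact Filter.Eventually.of_forall fun ω n m h =>
        ENNReal.ofReal_le_ofReal (truncFK_monotone hQ V hg x ω ht h)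
    · exact Filter.Eventually.of_forall fun ω =>
        (ENNReal.continuous_ofReal.tendsto _).comp (tendsto_truncFK hQ V g x ω ht)
  refine le_antisymm (le_of_tendsto' hlim fun n => truncFKMean_le_iSup_killedFlow hQ V hg n ht x) ?_
  refine iSup_le fun N => ?_
  obtain ⟨M, c, hM, h⟩ := exists_killedFlow_le_truncFKMean_add hQ V N hg
  have herr : Filter.Tendsto (fun n : ℕ => ENNReal.ofReal (M * Real.exp (c * t) * (1 / 2) ^ n))
      Filter.atTop (nhds 0) := by
    rw [← ENNReal.ofReal_zero]
    refine (ENNReal.continuous_ofReal.tendsto _).comp ?_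
    simpa using (tendsto_pow_atTop_nhds_zero_of_lt_one (r := (1 / 2 : ℝ)) (by norm_num)
      (by norm_num)).const_mul (M * Real.exp (c * t))
  have := ge_of_tendsto' (hlim.add herr) fun n => h n t ht x
  rwa [add_zero] at this

lemma valueAt_sub (Q : ℕ → ℕ → ℝ) (g₁ g₂ : ℕ → ℝ) (x : ℕ) (t : ℝ) (ω : Sample) :
    valueAt Q (fun y => g₁ y - g₂ y) x t ω = valueAt Q g₁ x t ω - valueAt Q g₂ x t ω := by
  unfold valueAt
  cases position Q x t ω <;> simp

lemma feynmanKacVar_nonneg (Q : ℕ → ℕ → ℝ) (V : ℕ → ℝ) {g : ℕ → ℝ} (hg : ∀ y, 0 ≤ g y) (t : ℝ)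
    (x : ℕ)
    (ω : Sample) : 0 ≤ feynmanKacVar Q V t g x ω := by
  refine mul_nonneg ?_ (Real.exp_pos _).le
  unfold valueAt
  cases position Q x t ω <;> simp [hg]

/-- If `ψ` is a nonnegative supersolution of an eigenvalue equation, then the Feynman-Kac semigroup
of each function dominated by `ψ` is given by absolutely convergent expectations and is the limit
of the killed semigroups. -/
theorem integrable_and_tendsto_killedFlow (hQ : IsSkipFree Q) (V : ℕ → ℝ) {g ψ : ℕ → ℝ} {c : ℝ}
    (hψ : ∀ y, 0 ≤ ψ y) (hgψ : ∀ y, |g y| ≤ ψ y) (hgen : ∀ x, gen Q V ψ x ≤ c * ψ x) {t : ℝ}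
    (ht : 0 ≤ t) (x : ℕ) :
    Integrable (feynmanKacVar Q V t g x) (sampleLaw Q) ∧
      Filter.Tendsto (fun N => killedFlow Q V N g t x) Filter.atTop
        (nhds (feynmanKac Q V t g x)) := by
  have key : ∀ k : ℕ → ℝ, (∀ y, 0 ≤ k y) → (∀ y, k y ≤ ψ y) →
      Integrable (feynmanKacVar Q V t k x) (sampleLaw Q) ∧
      Filter.Tendsto (fun N => killedFlow Q V N k t x) Filter.atTop
        (nhds (feynmanKac Q V t k x)) := by
    intro k hk hkψ
    have hl := lintegral_feynmanKacVar hQ V hk ht x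
    have hm := (hQ.measurable_feynmanKacVar V k ht x).aestronglyMeasurable (μ := sampleLaw Q)
    have hnn := Filter.Eventually.of_forall (f := ae (sampleLaw Q))
      (feynmanKacVar_nonneg Q V hk t x)
    have hfin : ⨆ N, ENNReal.ofReal (killedFlow Q V N k t x) ≠ ∞ := by
      refine ne_top_of_le_ne_top (ENNReal.ofReal_ne_top (r := Real.exp (c * t) * ψ x))
        (iSup_le fun N => ENNReal.ofReal_le_ofReal ?_)
      exact killedFlow_le_of_gen_le hQ V N hψ hkψ (fun x _ => hgen x) ht x
    refine ⟨⟨hm, ?_⟩, ?_⟩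
    · rw [hasFiniteIntegral_iff_ofReal hnn, hl]
      exact hfin.lt_top
    · rw [feynmanKac, integral_eq_lintegral_of_nonneg_ae hnn hm, hl]
      have h1 := (ENNReal.tendsto_toReal hfin).comp (tendsto_atTop_iSup
        (f := fun N => ENNReal.ofReal (killedFlow Q V N k t x))
        fun N M h => ENNReal.ofReal_le_ofReal (killedFlow_mono hQ V hk ht x h))
      refine h1.congr fun N => ?_
      exact ENNReal.toReal_ofReal (killedFlow_nonneg hQ V N hk ht x)
  obtain ⟨hi₁, ht₁⟩ := key (fun y => max (g y) 0) (fun y => le_max_right _ _)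
    (fun y => max_le ((le_abs_self _).trans (hgψ y)) (hψ y))
  obtain ⟨hi₂, ht₂⟩ := key (fun y => max (-g y) 0) (fun y => le_max_right _ _)
    (fun y => max_le ((neg_le_abs _).trans (hgψ y)) (hψ y))
  have hg : g = fun y => max (g y) 0 - max (-g y) 0 := by
    funext y
    exact (max_zero_sub_max_neg_zero_eq_self (g y)).symm
  have hvar : feynmanKacVar Q V t g x = feynmanKacVar Q V t (fun y => max (g y) 0) x
      - feynmanKacVar Q V t (fun y => max (-g y) 0) x := by
    funext ω
    conv_lhs => rw [hg]
    rw [feynmanKacVar, valueAt_sub, sub_mul]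
    rfl
  refine ⟨hvar ▸ hi₁.sub hi₂, ?_⟩
  rw [feynmanKac, hvar, integral_sub' hi₁ hi₂]
  refine (ht₁.sub ht₂).congr fun N => ?_
  conv_rhs => rw [hg]
  exact (linFlow_sub _ N _ _ t x).symm

end

/-! ### Intertwining relations -/

lemma bdRates_sum (α β w : ℕ → ℝ) (hβ0 : β 0 = 0) (x : ℕ) :
    ∑ y ∈ Finset.range (x + 2), bdRates α β x y * w y = α x * w (x + 1) + β x * w (x - 1) := by
  cases x with
  | zero => simp [bdRates, hβ0]
  | succ x =>
    rw [Finset.sum_range_succ, Finset.sum_range_succ, Finset.sum_range_succ,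
      Finset.sum_eq_zero (fun y hy => ?_)]
    · have : x ≠ x + 1 + 1 := by omega
      simp [bdRates, this]; ring
    · rw [Finset.mem_range] at hy
      rw [bdRates, if_neg (by omega), if_neg (by omega), zero_mul]

lemma totalRate_bdRates (α β : ℕ → ℝ) (hβ0 : β 0 = 0) (x : ℕ) :
    totalRate (bdRates α β) x = α x + β x := by
  have := bdRates_sum α β (fun _ => 1) hβ0 x
  simpa [totalRate] using this

lemma gen_bdRates (α β w : ℕ → ℝ) (hβ0 : β 0 = 0) (x : ℕ) :
    gen (bdRates α β) 0 w x = bdOp α β 0 w x := by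
  rw [gen, bdRates_sum α β w hβ0, totalRate_bdRates α β hβ0, bdOp]
  simp only [Pi.zero_apply]
  ring

lemma isSkipFree_bdRates {α β : ℕ → ℝ} (hβ0 : β 0 = 0) (hα : ∀ x, 0 ≤ α x) (hβ : ∀ x, 0 ≤ β x)
    (h : ∀ x, 0 < α x + β x) : IsSkipFree (bdRates α β) where
  nonneg x y := by
    unfold bdRates
    split_ifs
    exacts [hα x, hβ x, le_rfl]
  skip x y hxy := by rw [bdRates, if_neg (by omega), if_neg (by omega)]
  pos x := by rw [totalRate_bdRates α β hβ0]; exact h x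

/-- The weighted forward gradient intertwines the birth-death generator with the generator of the
birth-death process with rates `α_u`, `β_u` and potential `V_u`. -/
lemma fwdGrad_bdOp {α β u : ℕ → ℝ} (hβ0 : β 0 = 0) (hu : ∀ x, 0 < u x) (f : ℕ → ℝ) (x : ℕ) :
    fwdGrad u (bdOp α β 0 f) x =
      bdOp (alphaU α u) (betaU β u) (potU α β u) (fwdGrad u f) x := by
  have h0 := (hu x).ne'
  have h1 := (hu (x + 1)).ne'
  cases x with
  | zero =>
    simp only [fwdGrad, bdOp, alphaU, betaU, potU, hβ0, Pi.zero_apply]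
    field_simp
    ring_nf
  | succ x =>
    have h2 := (hu x).ne'
    simp only [fwdGrad, bdOp, alphaU, betaU, potU, Pi.zero_apply, Nat.add_sub_cancel]
    field_simp
    ring

/-- A function is recovered by summation from its weighted backward gradient. -/
lemma neg_sum_bwdGrad {v : ℕ → ℝ} (hv : ∀ x, 0 < v x) (w : ℕ → ℝ) (x : ℕ) :
    -∑ k ∈ Finset.range (x + 1), v k * bwdGrad v w k = w x := by
  induction x with
  | zero =>
    have := (hv 0).ne'
    simp [bwdGrad]; field_simp
  | succ x ih =>
    have := (hv (x + 1)).ne'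
    rw [Finset.sum_range_succ, neg_add, ih, bwdGrad]
    field_simp
    ring

lemma bwdGrad_neg_sum {v : ℕ → ℝ} (hv : ∀ x, 0 < v x) (h : ℕ → ℝ) (x : ℕ) :
    bwdGrad v (fun x => -∑ k ∈ Finset.range (x + 1), v k * h k) x = h x := by
  cases x with
  | zero =>
    have := (hv 0).ne'
    simp [bwdGrad]; field_simp
  | succ x =>
    have := (hv (x + 1)).ne'
    rw [bwdGrad, Finset.sum_range_succ _ (x + 1)]
    field_simp
    ring

lemma ratesUV_sum_zero (α β u v w : ℕ → ℝ) :
    ∑ y ∈ Finset.range 2, ratesUV α β u v 0 y * w y = alphaUV α u v 0 * w 1 := by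
  simp [ratesUV]

/-- The two cases of `β_{u,*v}` at positive states in one formula: `β_u 0 = 0`. -/
lemma betaUV_succ (α β u v : ℕ → ℝ) (x : ℕ) :
    betaUV α β u v (x + 1) =
      v x / v (x + 1) * betaU β u x + v x * bwdGrad v (potU α β u) (x + 1) := by
  cases x with
  | zero => simp [betaUV, betaU]
  | succ x => simp only [betaUV, betaU]; ring

/-- The part `v x * ∂*_v V_u` of the death rate completes the long jumps to the full sum over the
states below. -/
lemma ratesUV_sum_succ (α β u v w : ℕ → ℝ) (x : ℕ) :
    ∑ y ∈ Finset.range (x + 1 + 2), ratesUV α β u v (x + 1) y * w y =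
      alphaUV α u v (x + 1) * w (x + 2) + v x / v (x + 1) * betaU β u x * w x
        + bwdGrad v (potU α β u) (x + 1) * ∑ k ∈ Finset.range (x + 1), v k * w k := by
  have h1 : ∑ y ∈ Finset.range x, ratesUV α β u v (x + 1) y * w y
      = bwdGrad v (potU α β u) (x + 1) * ∑ k ∈ Finset.range x, v k * w k := by
    rw [Finset.mul_sum]
    refine Finset.sum_congr rfl fun y hy => ?_
    rw [Finset.mem_range] at hy
    rw [ratesUV, if_neg (by omega), if_neg (by omega), if_pos (by omega)]
    ring
  rw [Finset.sum_range_succ, Finset.sum_range_succ, Finset.sum_range_succ, h1,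
    Finset.sum_range_succ _ x]
  have h2 : ratesUV α β u v (x + 1) (x + 2) = alphaUV α u v (x + 1) := by simp [ratesUV]
  have h3 : ratesUV α β u v (x + 1) (x + 1) = 0 := by simp [ratesUV]
  have h4 : ratesUV α β u v (x + 1) x = betaUV α β u v (x + 1) := by
    rw [ratesUV, if_neg (by omega), if_pos rfl]
  rw [h2, h3, h4, betaUV_succ]
  ring

/-- The weighted backward gradient intertwines the generator of the birth-death process with rates
`α_u`, `β_u` and potential `V_u` with the generator of the process with rates `ratesUV` and
potential `V_{u,*v}`. -/
lemma bwdGrad_bdOp {α β u v : ℕ → ℝ} (hβ0 : β 0 = 0) (hu : ∀ x, 0 < u x) (hv : ∀ x, 0 < v x)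
    (g : ℕ → ℝ) (x : ℕ) :
    bwdGrad v (bdOp (alphaU α u) (betaU β u) (potU α β u) g) x =
      gen (ratesUV α β u v) (potUV α β u v) (bwdGrad v g) x := by
  have htot := fun x => ratesUV_sum_succ α β u v (fun _ => 1) x
  cases x with
  | zero =>
    have h0 := (hv 0).ne'
    have h1 := (hv 1).ne'
    have h2 := (hu 0).ne'
    have htot0 := ratesUV_sum_zero α β u v (fun _ => 1)
    simp only [mul_one] at htot0
    simp only [gen, totalRate, zero_add, ratesUV_sum_zero, htot0, bwdGrad, bdOp, potUV, alphaUV,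
      potU, alphaU, betaU]
    field_simp
    ring
  | succ x =>
    have h0 := (hv x).ne'
    have h1 := (hv (x + 1)).ne'
    have h2 := (hv (x + 2)).ne'
    have h3 := (hu x).ne'
    have h4 := (hu (x + 1)).ne'
    have hsum : ∑ k ∈ Finset.range (x + 1), v k * bwdGrad v g k = -g x := by
      rw [← neg_sum_bwdGrad hv g x, neg_neg]
    have ht := htot x
    simp only [mul_one] at ht
    have hb : v x / v (x + 1) * (u (x - 1) / u x) * β x = v x / v (x + 1) * betaU β u x := by
      cases x with
      | zero => simp [betaU, hβ0]
      | succ x => simp [betaU]; ring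
    have hg : g (x + 1) = g x - v (x + 1) * bwdGrad v g (x + 1) := by
      rw [bwdGrad]; field_simp; ring
    have hg2 : g (x + 2) = g (x + 1) - v (x + 2) * bwdGrad v g (x + 2) := by
      rw [bwdGrad]; field_simp; ring
    have hV : potU α β u (x + 1) =
        potU α β u x - v (x + 1) * bwdGrad v (potU α β u) (x + 1) := by
      rw [bwdGrad]; field_simp; ring
    have hb1 : betaU β u x * (g (x - 1) - g x) = betaU β u x * (v x * bwdGrad v g x) := by
      cases x with
      | zero => simp [betaU]
      | succ x => rw [bwdGrad, mul_div_cancel₀ _ h0]; rfl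
    have hVdef : alphaU α u x + betaU β u (x + 1) + potU α β u (x + 1) =
        (1 + u (x + 1) / u x) * α (x + 1) - u (x + 2) / u (x + 1) * α (x + 2) + β (x + 2) := by
      simp only [potU, alphaU]; ring
    have e1 : bwdGrad v (bdOp (alphaU α u) (betaU β u) (potU α β u) g) (x + 1) =
        (v x * betaU β u x * bwdGrad v g x
          + alphaU α u (x + 1) * v (x + 2) * bwdGrad v g (x + 2)
          - v (x + 1) * bwdGrad v (potU α β u) (x + 1) * g x
          - (alphaU α u x + betaU β u (x + 1) + potU α β u (x + 1))
            * (v (x + 1) * bwdGrad v g (x + 1))) / v (x + 1) := by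
      rw [bwdGrad]
      congr 1
      simp only [bdOp, Nat.add_sub_cancel, hb1]
      rw [hg2, hg, hV]
      ring
    rw [e1, hVdef, gen, totalRate, ht, ratesUV_sum_succ, hsum, potUV, hb]
    simp only [alphaUV, alphaU]
    generalize bwdGrad v (potU α β u) (x + 1) = D
    generalize betaU β u x = b
    generalize bwdGrad v g x = k0
    generalize bwdGrad v g (x + 1) = k1
    generalize bwdGrad v g (x + 2) = k2
    field_simp
    ring

lemma isSkipFree_ratesUV {α β u v : ℕ → ℝ} (hα : ∀ x, 0 < α x) (hβ : ∀ x, 0 ≤ β x)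
    (hu : ∀ x, 0 < u x) (hv : ∀ x, 0 < v x) (hVu : Antitone (potU α β u)) :
    IsSkipFree (ratesUV α β u v) := by
  have hαuv : ∀ x, 0 < alphaUV α u v x := fun x =>
    mul_pos (mul_pos (div_pos (hv _) (hv _)) (div_pos (hu _) (hu _))) (hα _)
  have hD : ∀ x, 0 ≤ bwdGrad v (potU α β u) (x + 1) := fun x =>
    div_nonneg (sub_nonneg.2 (hVu (Nat.le_succ x))) (hv _).le
  have hb : ∀ x, 0 ≤ betaU β u x := by
    intro x
    cases x with
    | zero => exact le_rfl
    | succ x => exact mul_nonneg (div_pos (hu _) (hu _)).le (hβ _)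
  have hnn : ∀ x y, 0 ≤ ratesUV α β u v x y := by
    intro x y
    unfold ratesUV
    split_ifs with h1 h2 h3
    · exact (hαuv x).le
    · rw [← h2, betaUV_succ]
      exact add_nonneg (mul_nonneg (div_pos (hv _) (hv _)).le (hb _)) (mul_nonneg (hv _).le (hD _))
    · obtain ⟨z, rfl⟩ : ∃ z, x = z + 1 := ⟨x - 1, by omega⟩
      exact mul_nonneg (hD z) (hv y).le
    · exact le_rfl
  refine ⟨hnn, fun x y hxy => ?_, fun x => ?_⟩
  · rw [ratesUV, if_neg (by omega), if_neg (by omega), if_neg (by omega)]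
  · have h1 : ratesUV α β u v x (x + 1) = alphaUV α u v x := by simp [ratesUV]
    refine (h1 ▸ hαuv x).trans_le ?_
    exact Finset.single_le_sum (f := fun y => ratesUV α β u v x y) (fun y _ => hnn x y)
      (Finset.mem_range.2 (by omega))

lemma gen_const {Q : ℕ → ℕ → ℝ} (V : ℕ → ℝ) (c : ℝ) (x : ℕ) : gen Q V
    (fun _ => c) x = -(V x * c) := by
  rw [gen, ← Finset.sum_mul, totalRate]; ring

/-! ### Lyapunov functions -/

/-- The terms of the non-explosion series. -/
noncomputable def explosionTerm (α β : ℕ → ℝ) (j : ℕ) : ℝ :=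
  ∑ k ∈ Finset.range (j + 1), (∏ i ∈ Finset.Ioc k j, β i) / ∏ i ∈ Finset.Icc k j, α i

/-- The recursion expressing that the increments of `explosionBarrier` solve `L φ = 1`. -/
lemma explosionTerm_succ {α β : ℕ → ℝ} (hα : ∀ x, 0 < α x) (j : ℕ) :
    α (j + 1) * explosionTerm α β (j + 1) = 1 + β (j + 1) * explosionTerm α β j := by
  have h1 := (hα (j + 1)).ne'
  rw [explosionTerm, Finset.sum_range_succ, mul_add, add_comm]
  congr 1
  · simp [h1]
  · rw [explosionTerm, Finset.mul_sum, Finset.mul_sum]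
    refine Finset.sum_congr rfl fun k hk => ?_
    rw [Finset.mem_range] at hk
    rw [Finset.prod_Ioc_succ_top (by omega), Finset.prod_Icc_succ_top (by omega)]
    have h2 : ∏ i ∈ Finset.Icc k j, α i ≠ 0 := Finset.prod_ne_zero_iff.2 fun i _ => (hα i).ne'
    field_simp

/-- A solution of `L φ = 1` for the birth-death generator `L`; it is unbounded if and only if the
process does not explode. -/
noncomputable def explosionBarrier (α β : ℕ → ℝ) (x : ℕ) : ℝ :=
  1 + ∑ j ∈ Finset.range x, explosionTerm α β j

lemma bdOp_explosionBarrier {α β : ℕ → ℝ} (hα : ∀ x, 0 < α x) (x : ℕ) :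
    bdOp α β 0 (explosionBarrier α β) x = 1 := by
  cases x with
  | zero =>
    have := (hα 0).ne'
    simp [bdOp, explosionBarrier, explosionTerm, this]
  | succ x =>
    have := explosionTerm_succ (β := β) hα x
    simp only [bdOp, explosionBarrier, Finset.sum_range_succ, Nat.add_sub_cancel, Pi.zero_apply]
    linarith

lemma explosionTerm_nonneg {α β : ℕ → ℝ} (hα : ∀ x, 0 < α x) (hβ : ∀ x, 0 ≤ β x) (j : ℕ) :
    0 ≤ explosionTerm α β j :=
  Finset.sum_nonneg fun _ _ => div_nonneg (Finset.prod_nonneg fun i _ => hβ i)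
    (Finset.prod_nonneg fun i _ => (hα i).le)

lemma one_le_explosionBarrier {α β : ℕ → ℝ} (hα : ∀ x, 0 < α x) (hβ : ∀ x, 0 ≤ β x) (x : ℕ) :
    1 ≤ explosionBarrier α β x :=
  le_add_of_nonneg_right (Finset.sum_nonneg fun j _ => explosionTerm_nonneg hα hβ j)

lemma tendsto_explosionBarrier {α β : ℕ → ℝ} (hα : ∀ x, 0 < α x) (hβ : ∀ x, 0 ≤ β x)
    (hexp : NonExplosiveRates α β) :
    Filter.Tendsto (explosionBarrier α β) Filter.atTop Filter.atTop := by
  have h0 : ¬ Summable fun x => explosionTerm α β (x + 1) := hexp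
  have h1 : ¬ Summable (explosionTerm α β) := fun h => h0 ((summable_nat_add_iff 1).2 h)
  rw [not_summable_iff_tendsto_nat_atTop_of_nonneg (explosionTerm_nonneg hα hβ)] at h1
  exact Filter.tendsto_atTop_add_const_left _ _ h1

/-- If `V_u` is bounded from below, then the function with `∂_u F = 1` is a Lyapunov function of
the birth-death process. -/
lemma bdOp_sum_le {α β u : ℕ → ℝ} (hβ0 : β 0 = 0) (hu : ∀ x, 0 < u x) {K : ℝ}
    (hK : ∀ x, -K ≤ potU α β u x) (x : ℕ) :
    bdOp α β 0 (fun x => ∑ k ∈ Finset.range x, u k) x ≤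
      α 0 * u 0 + K * ∑ k ∈ Finset.range x, u k := by
  set F : ℕ → ℝ := fun x => ∑ k ∈ Finset.range x, u k with hF
  have hgrad : fwdGrad u F = fun _ => 1 := by
    funext x
    simp only [fwdGrad, hF, Finset.sum_range_succ, add_sub_cancel_left]
    exact div_self (hu x).ne'
  induction x with
  | zero => simp [bdOp, hF]
  | succ x ih =>
    have h1 := fwdGrad_bdOp (α := α) hβ0 hu F x
    rw [hgrad, fwdGrad, div_eq_iff (hu x).ne'] at h1
    have h2 : bdOp (alphaU α u) (betaU β u) (potU α β u) (fun _ => (1 : ℝ)) x = -potU α β u x := by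
      simp [bdOp]
    rw [h2] at h1
    rw [Finset.sum_range_succ]
    have h3 := mul_le_mul_of_nonneg_right (hK x) (hu x).le
    linarith

/-- If `V_{u,*v}` is bounded from below, then the function with `∂*_v G = -1` is a Lyapunov function
of the birth-death process with rates `α_u`, `β_u` and potential `V_u`. -/
lemma bdOp_weight_le {α β u v : ℕ → ℝ} (hβ0 : β 0 = 0) (hu : ∀ x, 0 < u x) (hv : ∀ x, 0 < v x)
    {K : ℝ} (hK : ∀ x, -K ≤ potUV α β u v x) (x : ℕ) :
    bdOp (alphaU α u) (betaU β u) (potU α β u) (fun x => ∑ k ∈ Finset.range (x + 1), v k) x ≤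
      K * ∑ k ∈ Finset.range (x + 1), v k := by
  set G : ℕ → ℝ := fun x => ∑ k ∈ Finset.range (x + 1), v k with hG
  have hgrad : bwdGrad v G = fun _ => -1 := by
    funext x
    rw [← bwdGrad_neg_sum hv (fun _ => -1) x]
    congr 1
    funext x
    simp [hG]
  rw [← neg_sum_bwdGrad hv (bdOp (alphaU α u) (betaU β u) (potU α β u) G) x, Finset.mul_sum,
    ← Finset.sum_neg_distrib]
  refine Finset.sum_le_sum fun k _ => ?_
  rw [bwdGrad_bdOp hβ0 hu hv, hgrad, gen_const]
  have h3 := mul_le_mul_of_nonneg_left (hK k) (hv k).le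
  linarith

/-! ### Convergence of the finite systems -/

lemma bdOp_sub (a b V w₁ w₂ : ℕ → ℝ) (x : ℕ) :
    bdOp a b V (fun y => w₁ y - w₂ y) x = bdOp a b V w₁ x - bdOp a b V w₂ x := by
  unfold bdOp; ring

lemma bdOp_const_mul (a b V w : ℕ → ℝ) (c : ℝ) (x : ℕ) :
    bdOp a b V (fun y => c * w y) x = c * bdOp a b V w x := by
  unfold bdOp; ring

lemma betaU_nonneg {β u : ℕ → ℝ} (hβ : ∀ x, 0 ≤ β x) (hu : ∀ x, 0 < u x) (x : ℕ) :
    0 ≤ betaU β u x := by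
  cases x with
  | zero => exact le_rfl
  | succ x => exact mul_nonneg (div_pos (hu _) (hu _)).le (hβ _)

/-- Solutions of a birth-death equation on `{0, …, n - 1}` are dominated by supersolutions of the
form `exp (c t) ψ x`, with a domination or a reflection condition at `n`. -/
lemma abs_le_exp_mul {n : ℕ} {a b V : ℕ → ℝ} (ha : ∀ x, 0 ≤ a x) (hb : ∀ x, 0 ≤ b x)
    {D : ℝ → ℕ → ℝ} {ψ : ℕ → ℝ} {c : ℝ}
    (hd : ∀ t, 0 ≤ t → ∀ x < n, HasDerivAt (fun s => D s x) (bdOp a b V (D t) x) t)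
    (hψ : ∀ x < n, bdOp a b V ψ x ≤ c * ψ x)
    (h0 : ∀ x < n, |D 0 x| ≤ ψ x)
    (hn : ∀ t, 0 ≤ t → |D t n| ≤ Real.exp (c * t) * ψ n ∨ (D t n = D t (n - 1) ∧ ψ (n - 1) ≤ ψ n))
    {t : ℝ} (ht : 0 ≤ t) {x : ℕ} (hx : x < n) : |D t x| ≤ Real.exp (c * t) * ψ x := by
  have key : ∀ σ : ℝ, (∀ r, σ * r ≤ |r|) → 0 ≤ Real.exp (c * t) * ψ x - σ * D t x := by
    intro σ hσ
    refine nonneg_of_deriv_ge_bdOp (n := n) (V := V) ha hb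
      (E := fun t x => Real.exp (c * t) * ψ x - σ * D t x)
      (fun t ht x hx => ((((hasDerivAt_id t).const_mul c).exp.mul_const (ψ x)).sub
        ((hd t ht x hx).const_mul σ))) ?_ ?_ ?_ ht hx
    · intro x hx
      have := (hσ (D 0 x)).trans (h0 x hx)
      simpa using this
    · intro t ht
      rcases hn t ht with h | ⟨h1, h2⟩
      · exact (min_le_right _ _).trans (sub_nonneg.2 ((hσ _).trans h))
      · refine (min_le_left _ _).trans ?_
        rw [h1]
        exact sub_le_sub_right (mul_le_mul_of_nonneg_left h2 (Real.exp_pos _).le) _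
    · intro t ht x hx
      rw [bdOp_sub, bdOp_const_mul, bdOp_const_mul]
      have := mul_le_mul_of_nonneg_left (hψ x hx) (Real.exp_pos (c * t)).le
      simp only [id, mul_one]
      linarith
  rw [abs_le]
  have h1 := key 1 fun r => by simpa using le_abs_self r
  have h2 := key (-1) fun r => by simpa using neg_le_abs r
  constructor <;> linarith

lemma hasDerivAt_killedFlow_gen {Q : ℕ → ℕ → ℝ} (hQ : IsSkipFree Q) (V : ℕ → ℝ) (N : ℕ) (g : ℕ → ℝ)
    (t : ℝ) {x : ℕ} (h : x < N) :
    HasDerivAt (fun s => killedFlow Q V N g s x) (gen Q V (killedFlow Q V N g t) x) t := by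
  refine (hasDerivAt_killedFlow Q V N g t h).congr_deriv ?_
  rw [gen]
  congr 1
  rcases Nat.lt_or_ge N (x + 2) with hN | hN
  · refine Finset.sum_subset (Finset.range_mono hN.le) fun y _ hy => ?_
    rw [killedFlow_of_le (by simpa using hy), mul_zero]
  · exact hQ.sum_range_eq _ hN

/-- The semigroup of the birth-death process with reflection at `n` (its birth rate at `n` is set to
`0`), extended to a function on `ℕ` which is constant on `{n, n + 1, …}`. -/
noncomputable def reflectedFlow (α β : ℕ → ℝ) (n : ℕ) (f : ℕ → ℝ) (t : ℝ) (x : ℕ) : ℝ :=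
  killedFlow (bdRates (fun x => if x < n then α x else 0) β) 0 (n + 1) f t (min x n)

/-- The process with rates `ratesUV` and potential `V_{u,*v}` killed at `n`, integrated to a
solution of the equation with rates `α_u`, `β_u` and potential `V_u` which is reflected at
`n - 1`. -/
noncomputable def summedFlow (α β u v : ℕ → ℝ) (n : ℕ) (h : ℕ → ℝ) (t : ℝ) (x : ℕ) : ℝ :=
  -∑ k ∈ Finset.range (x + 1), v k * killedFlow (ratesUV α β u v) (potUV α β u v) n h t k

lemma hasDerivAt_reflectedFlow {α β : ℕ → ℝ} (hα : ∀ x, 0 < α x) (hβ0 : β 0 = 0)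
    (hβ : ∀ x, 1 ≤ x → 0 < β x) {n : ℕ} (hn : 1 ≤ n) (f : ℕ → ℝ) (t : ℝ) {x : ℕ} (hx : x ≤ n) :
    HasDerivAt (fun s => reflectedFlow α β n f s x) (bdOp α β 0 (reflectedFlow α β n f t) x) t := by
  have hQ : IsSkipFree (bdRates (fun x => if x < n then α x else 0) β) := by
    refine isSkipFree_bdRates hβ0 (fun x => ?_) (fun x => ?_) (fun x => ?_)
    · split_ifs
      exacts [(hα x).le, le_rfl]
    · rcases Nat.eq_zero_or_pos x with rfl | h
      exacts [hβ0.ge, (hβ x h).le]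
    · rcases Nat.eq_zero_or_pos x with rfl | h
      · rw [if_pos (by omega), hβ0, add_zero]
        exact hα 0
      · refine add_pos_of_nonneg_of_pos ?_ (hβ x h)
        split_ifs
        exacts [(hα x).le, le_rfl]
  have h1 := hasDerivAt_killedFlow_gen hQ 0 (n + 1) f t (x := x) (by omega)
  rw [gen_bdRates _ _ _ hβ0] at h1
  unfold reflectedFlow
  rw [min_eq_left hx]
  refine h1.congr_deriv ?_
  simp only [bdOp, min_eq_left hx, min_eq_left (show x - 1 ≤ n by omega)]
  rcases hx.lt_or_eq with h | h
  · rw [if_pos h, min_eq_left (show x + 1 ≤ n by omega)]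
  · rw [if_neg (by omega), min_eq_right (show n ≤ x + 1 by omega), h]
    ring

lemma reflectedFlow_zero (α β : ℕ → ℝ) {n : ℕ} (f : ℕ → ℝ) {x : ℕ} (hx : x ≤ n) :
    reflectedFlow α β n f 0 x = f x := by
  rw [reflectedFlow, min_eq_left hx]
  exact linFlow_zero (by omega)

lemma reflectedFlow_succ (α β : ℕ → ℝ) {n : ℕ} (f : ℕ → ℝ) (t : ℝ) {x : ℕ} (hx : n ≤ x) :
    reflectedFlow α β n f t (x + 1) = reflectedFlow α β n f t x := by
  rw [reflectedFlow, reflectedFlow, min_eq_right hx, min_eq_right (by omega)]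

lemma feynmanKacVar_zero (Q : ℕ → ℕ → ℝ) (f : ℕ → ℝ) (t : ℝ) (x : ℕ) :
    feynmanKacVar Q 0 t f x = valueAt Q f x t := by
  funext ω
  have : ∀ s, valueAt Q 0 x s ω = 0 := fun s => by
    unfold valueAt
    cases position Q x s ω <;> rfl
  simp [feynmanKacVar, this]

lemma feynmanKac_zero (Q : ℕ → ℕ → ℝ) (f : ℕ → ℝ) (t : ℝ) (x : ℕ) :
    feynmanKac Q 0 t f x = semigroup Q t f x := by
  rw [feynmanKac, feynmanKacVar_zero]; rfl

/-- As the process does not explode, the reflected semigroups converge to the semigroup on bounded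
functions. -/
lemma tendsto_reflectedFlow {α β : ℕ → ℝ} (hα : ∀ x, 0 < α x) (hβ0 : β 0 = 0)
    (hβ : ∀ x, 1 ≤ x → 0 < β x) (hexp : NonExplosiveRates α β) {f : ℕ → ℝ} {B : ℝ}
    (hf : ∀ x, |f x| ≤ B) {t : ℝ} (ht : 0 ≤ t) (x : ℕ) :
    Filter.Tendsto (fun n => reflectedFlow α β n f t x) Filter.atTop
      (nhds (semigroup (bdRates α β) t f x)) := by
  have hα' : ∀ x, 0 ≤ α x := fun x => (hα x).le
  have hβ' : ∀ x, 0 ≤ β x := fun x => by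
    rcases Nat.eq_zero_or_pos x with rfl | h
    exacts [hβ0.ge, (hβ x h).le]
  have hB : 0 ≤ B := (abs_nonneg _).trans (hf 0)
  have hQ : IsSkipFree (bdRates α β) :=
    isSkipFree_bdRates hβ0 hα' hβ' fun x => add_pos_of_pos_of_nonneg (hα x) (hβ' x)
  have hK : Filter.Tendsto (fun n => killedFlow (bdRates α β) 0 n f t x) Filter.atTop
      (nhds (semigroup (bdRates α β) t f x)) := by
    rw [← feynmanKac_zero]
    refine (integrable_and_tendsto_killedFlow hQ 0 (ψ := fun _ => B) (c := 0) (fun _ => hB) hf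
      (fun x => ?_) ht x).2
    simp [gen_const]
  set φ := explosionBarrier α β with hφ
  have hφ1 := one_le_explosionBarrier (α := α) (β := β) hα hβ'
  have hbound : ∀ n, max 1 (x + 1) ≤ n →
      |reflectedFlow α β n f t x - killedFlow (bdRates α β) 0 n f t x|
        ≤ Real.exp (1 * t) * (B * φ x / φ n) := by
    intro n hn
    have hn1 : 1 ≤ n := (le_max_left _ _).trans hn
    have hxn : x < n := (le_max_right _ _).trans hn
    have hR : ∀ t, 0 ≤ t → |reflectedFlow α β n f t n| ≤ B := by
      intro t ht
      have := abs_le_exp_mul (n := n + 1) (V := 0) hα' hβ' (D := reflectedFlow α β n f)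
        (ψ := fun _ => B) (c := 0)
        (fun t _ x hx => hasDerivAt_reflectedFlow hα hβ0 hβ hn1 f t (by omega))
        (fun x _ => by simp [bdOp])
        (fun x hx => by rw [reflectedFlow_zero α β f (by omega)]; exact hf x)
        (fun t _ => Or.inr ⟨reflectedFlow_succ α β f t le_rfl, le_rfl⟩) ht (Nat.lt_succ_self n)
      simpa using this
    have hφn : 0 < φ n := zero_lt_one.trans_le (hφ1 n)
    refine abs_le_exp_mul (n := n) (V := 0) hα' hβ'
      (D := fun t x => reflectedFlow α β n f t x - killedFlow (bdRates α β) 0 n f t x)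
      (ψ := fun x => B * φ x / φ n) (c := 1) ?_ ?_ ?_ ?_ ht hxn
    · intro t _ x hx
      rw [bdOp_sub]
      have h1 := hasDerivAt_killedFlow_gen hQ 0 n f t hx
      rw [gen_bdRates α β _ hβ0] at h1
      exact (hasDerivAt_reflectedFlow hα hβ0 hβ hn1 f t hx.le).sub h1
    · intro x _
      have : (fun x => B * φ x / φ n) = fun x => (B / φ n) * φ x := by
        funext x; ring
      rw [this, bdOp_const_mul, bdOp_explosionBarrier hα, one_mul]
      refine (mul_le_mul_of_nonneg_left (hφ1 x) (div_nonneg hB hφn.le)).trans (le_of_eq ?_)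
      change B / φ n * φ x = _
      ring
    · intro x hx
      rw [reflectedFlow_zero α β f hx.le]
      have : killedFlow (bdRates α β) 0 n f 0 x = f x := linFlow_zero hx
      rw [this, sub_self, abs_zero]
      exact div_nonneg (mul_nonneg hB (zero_le_one.trans (hφ1 x))) hφn.le
    · intro t ht
      left
      rw [killedFlow_of_le le_rfl, sub_zero, mul_div_assoc, div_self hφn.ne', mul_one]
      refine (hR t ht).trans (le_mul_of_one_le_left hB ?_)
      exact Real.one_le_exp (by linarith)
  have hlim : Filter.Tendsto (fun n => Real.exp (1 * t) * (B * φ x / φ n)) Filter.atTop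
      (nhds 0) := by
    have := (Filter.Tendsto.const_div_atTop (tendsto_explosionBarrier hα hβ' hexp)
      (B * φ x)).const_mul (Real.exp (1 * t))
    simpa using this
  have hdiff : Filter.Tendsto (fun n => reflectedFlow α β n f t x
      - killedFlow (bdRates α β) 0 n f t x) Filter.atTop (nhds 0) := by
    refine squeeze_zero_norm' ?_ hlim
    filter_upwards [Filter.eventually_ge_atTop (max 1 (x + 1))] with n hn
    exact hbound n hn
  simpa using hdiff.add hK

/-- The difference between the gradient of the reflected birth-death semigroup and the summed killed
semigroup vanishes in the limit: both solve the same birth-death equation with the same initial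
values and stay bounded, while the equation has an unbounded Lyapunov function. -/
lemma tendsto_summedFlow_sub {α β u v : ℕ → ℝ} (hα : ∀ x, 0 < α x) (hβ0 : β 0 = 0)
    (hβ : ∀ x, 1 ≤ x → 0 < β x) (hu : ∀ x, 0 < u x) (hVu : Antitone (potU α β u))
    {ε : ℝ} (hε : 0 < ε) (hv : ∀ x, ε ≤ v x) {K : ℝ}
    (hK : ∀ x, -K ≤ potU α β u x) (hK' : ∀ x, -K ≤ potUV α β u v x)
    {f : ℕ → ℝ} {C : ℝ} (hf : ∀ x, |fwdGrad u f x| ≤ C) {t : ℝ} (ht : 0 ≤ t) (x : ℕ) :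
    Filter.Tendsto (fun n => summedFlow α β u v n (bwdGrad v (fwdGrad u f)) t x
      - fwdGrad u (reflectedFlow α β n f t) x) Filter.atTop (nhds 0) := by
  have hv0 : ∀ x, 0 < v x := fun x => hε.trans_le (hv x)
  have hβ' : ∀ x, 0 ≤ β x := fun x => by
    rcases Nat.eq_zero_or_pos x with rfl | h
    exacts [hβ0.ge, (hβ x h).le]
  have hC : 0 ≤ C := (abs_nonneg _).trans (hf 0)
  have ha : ∀ x, 0 ≤ alphaU α u x := fun x => mul_nonneg (div_pos (hu _) (hu _)).le (hα _).le
  have hb := betaU_nonneg hβ' hu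
  have hQ := isSkipFree_ratesUV hα hβ' hu hv0 hVu
  set h := bwdGrad v (fwdGrad u f) with hh
  set W : ℕ → ℝ := fun x => ∑ k ∈ Finset.range (x + 1), v k with hW
  have hWpos : ∀ x, 0 < W x := fun x =>
    Finset.sum_pos (fun k _ => hv0 k) ⟨0, by simp⟩
  have hWlim : Filter.Tendsto W Filter.atTop Filter.atTop := by
    refine Filter.tendsto_atTop_mono (fun n => ?_)
      ((tendsto_natCast_atTop_atTop (R := ℝ)).atTop_mul_const hε)
    calc (n : ℝ) * ε ≤ ∑ _k ∈ Finset.range (n + 1), ε := by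
          rw [Finset.sum_const, Finset.card_range, nsmul_eq_mul]
          push_cast
          nlinarith
      _ ≤ W n := Finset.sum_le_sum fun k _ => hv k
  have hconst : ∀ x, bdOp (alphaU α u) (betaU β u) (potU α β u) (fun _ => C) x ≤ K * C := by
    intro x
    have := mul_le_mul_of_nonneg_right (hK x) hC
    simp only [bdOp, sub_self, mul_zero, zero_add, zero_sub]
    linarith
  have hSd : ∀ n t, ∀ x < n, HasDerivAt (fun s => summedFlow α β u v n h s x)
      (bdOp (alphaU α u) (betaU β u) (potU α β u) (summedFlow α β u v n h t) x) t := by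
    intro n t x hx
    rw [← neg_sum_bwdGrad hv0 (bdOp (alphaU α u) (betaU β u) (potU α β u)
      (summedFlow α β u v n h t)) x]
    refine (HasDerivAt.fun_sum fun k hk => ?_).neg
    rw [bwdGrad_bdOp hβ0 hu hv0]
    have e : bwdGrad v (summedFlow α β u v n h t)
        = killedFlow (ratesUV α β u v) (potUV α β u v) n h t :=
      funext fun x => bwdGrad_neg_sum hv0 _ x
    rw [e]
    exact (hasDerivAt_killedFlow_gen hQ _ n h t
      (by rw [Finset.mem_range] at hk; omega)).const_mul (v k)
  have hS0 : ∀ n, ∀ x < n, summedFlow α β u v n h 0 x = fwdGrad u f x := by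
    intro n x hx
    rw [← neg_sum_bwdGrad hv0 (fwdGrad u f) x, summedFlow]
    congr 1
    refine Finset.sum_congr rfl fun k hk => ?_
    rw [Finset.mem_range] at hk
    have : killedFlow (ratesUV α β u v) (potUV α β u v) n h 0 k = h k := linFlow_zero (by omega)
    rw [this]
  have hSn : ∀ n t, 1 ≤ n → summedFlow α β u v n h t n = summedFlow α β u v n h t (n - 1) := by
    intro n t hn
    rw [summedFlow, Finset.sum_range_succ, killedFlow_of_le le_rfl, mul_zero, add_zero, summedFlow,
      Nat.sub_add_cancel hn]
  have hSb : ∀ n t, 1 ≤ n → 0 ≤ t → |summedFlow α β u v n h t n| ≤ Real.exp (K * t) * C := by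
    intro n t hn ht
    rw [hSn n t hn]
    refine abs_le_exp_mul (n := n) ha hb (ψ := fun _ => C) (fun t _ x hx => hSd n t x hx)
      (fun x _ => hconst x) (fun x hx => ?_) (fun t _ => Or.inr ⟨hSn n t hn, le_rfl⟩) ht (by omega)
    rw [hS0 n x hx]
    exact hf x
  have hbound : ∀ n, x + 1 ≤ n → |summedFlow α β u v n h t x
      - fwdGrad u (reflectedFlow α β n f t) x| ≤ Real.exp (K * t) * (C * W x / W n) := by
    intro n hn
    refine abs_le_exp_mul (n := n) (V := potU α β u) ha hb
      (D := fun t x => summedFlow α β u v n h t x - fwdGrad u (reflectedFlow α β n f t) x)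
      (ψ := fun x => C * W x / W n) (c := K) ?_ ?_ ?_ ?_ ht hn
    · intro t _ x hx
      rw [bdOp_sub]
      refine (hSd n t x hx).sub ?_
      rw [← fwdGrad_bdOp hβ0 hu]
      exact ((hasDerivAt_reflectedFlow hα hβ0 hβ (by omega) f t (by omega)).sub
        (hasDerivAt_reflectedFlow hα hβ0 hβ (by omega) f t hx.le)).div_const _
    · intro x _
      have : (fun x => C * W x / W n) = fun x => (C / W n) * W x := by
        funext x; ring
      rw [this, bdOp_const_mul]
      have h1 := bdOp_weight_le hβ0 hu hv0 hK' x
      have h2 : 0 ≤ C / W n := div_nonneg hC (hWpos n).le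
      refine (mul_le_mul_of_nonneg_left h1 h2).trans (le_of_eq ?_)
      change C / W n * (K * W x) = _
      ring
    · intro x hx
      rw [hS0 n x hx]
      have h1 : fwdGrad u (reflectedFlow α β n f 0) x = fwdGrad u f x := by
        rw [fwdGrad, reflectedFlow_zero α β f hx.le, reflectedFlow_zero α β f hx, fwdGrad]
      rw [h1, sub_self, abs_zero]
      exact div_nonneg (mul_nonneg hC (hWpos x).le) (hWpos n).le
    · intro t ht
      left
      have h1 : fwdGrad u (reflectedFlow α β n f t) n = 0 := by
        rw [fwdGrad, reflectedFlow_succ α β f t le_rfl, sub_self, zero_div]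
      rw [h1, sub_zero, mul_div_assoc, div_self (hWpos n).ne', mul_one]
      exact hSb n t (by omega) ht
  have hlim : Filter.Tendsto (fun n => Real.exp (K * t) * (C * W x / W n)) Filter.atTop
      (nhds 0) := by
    have := (Filter.Tendsto.const_div_atTop hWlim (C * W x)).const_mul (Real.exp (K * t))
    simpa using this
  refine squeeze_zero_norm' ?_ hlim
  filter_upwards [Filter.eventually_ge_atTop (x + 1)] with n hn
  exact hbound n hn

lemma tendsto_bwdGrad (v : ℕ → ℝ) {w : ℕ → ℕ → ℝ} {w' : ℕ → ℝ}
    (h : ∀ x, Filter.Tendsto (fun n => w n x) Filter.atTop (nhds (w' x))) (x : ℕ) :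
    Filter.Tendsto (fun n => bwdGrad v (w n) x) Filter.atTop (nhds (bwdGrad v w' x)) := by
  cases x with
  | zero => exact (h 0).neg.div_const _
  | succ x => exact ((h x).sub (h (x + 1))).div_const _

lemma tendsto_fwdGrad (u : ℕ → ℝ) {w : ℕ → ℕ → ℝ} {w' : ℕ → ℝ}
    (h : ∀ x, Filter.Tendsto (fun n => w n x) Filter.atTop (nhds (w' x))) (x : ℕ) :
    Filter.Tendsto (fun n => fwdGrad u (w n) x) Filter.atTop (nhds (fwdGrad u w' x)) :=
  ((h (x + 1)).sub (h x)).div_const _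

/-- Dominated convergence for the Feynman-Kac semigroup. -/
lemma tendsto_feynmanKac {Q : ℕ → ℕ → ℝ} (hQ : IsSkipFree Q) (V : ℕ → ℝ) {t : ℝ} (ht : 0 ≤ t)
    (x : ℕ) {g : ℕ → ℕ → ℝ} {g' b : ℕ → ℝ} (hb : Integrable (feynmanKacVar Q V t b x) (sampleLaw Q))
    (hgb : ∀ m y, |g m y| ≤ b y)
    (hg : ∀ y, Filter.Tendsto (fun m => g m y) Filter.atTop (nhds (g' y))) :
    Filter.Tendsto (fun m => feynmanKac Q V t (g m) x) Filter.atTop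
      (nhds (feynmanKac Q V t g' x)) := by
  refine tendsto_integral_of_dominated_convergence (feynmanKacVar Q V t b x)
    (fun m => (hQ.measurable_feynmanKacVar V (g m) ht x).aestronglyMeasurable) hb
    (fun m => Filter.Eventually.of_forall fun ω => ?_) (Filter.Eventually.of_forall fun ω => ?_)
  · rw [feynmanKacVar, norm_mul, Real.norm_of_nonneg (Real.exp_pos _).le]
    refine mul_le_mul_of_nonneg_right ?_ (Real.exp_pos _).le
    unfold valueAt
    cases position Q x t ω with
    | none => simp
    | some y => exact hgb m y
  · refine Filter.Tendsto.mul_const _ ?_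
    unfold valueAt
    cases position Q x t ω with
    | none => exact tendsto_const_nhds
    | some y => exact hg y

lemma abs_bwdGrad_le {v : ℕ → ℝ} {ε : ℝ} (hε : 0 < ε) (hv : ∀ x, ε ≤ v x) {g : ℕ → ℝ} {C : ℝ}
    (hg : ∀ x, |g x| ≤ C) (x : ℕ) : |bwdGrad v g x| ≤ 2 * C / ε := by
  have hC : 0 ≤ C := (abs_nonneg _).trans (hg 0)
  have key : ∀ r y, |r| ≤ 2 * C → |r / v y| ≤ 2 * C / ε := by
    intro r y hr
    rw [abs_div, abs_of_pos (hε.trans_le (hv y))]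
    exact div_le_div₀ (by linarith) hr hε (hv y)
  cases x with
  | zero =>
    refine key _ _ ?_
    rw [abs_neg]
    linarith [hg 0]
  | succ x =>
    refine key _ _ ((abs_sub _ _).trans ?_)
    linarith [hg x, hg (x + 1)]

/-! ### The intertwining of the semigroups -/

/-- The intertwining relation for bounded functions. -/
lemma bwdGrad_fwdGrad_semigroup_of_bounded {α β u v : ℕ → ℝ} (hα : ∀ x, 0 < α x) (hβ0 : β 0 = 0)
    (hβ : ∀ x, 1 ≤ x → 0 < β x) (hexp : NonExplosiveRates α β) (hu : ∀ x, 0 < u x)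
    (hVu : Antitone (potU α β u)) {ε : ℝ} (hε : 0 < ε) (hv : ∀ x, ε ≤ v x) {K : ℝ}
    (hK : ∀ x, -K ≤ potU α β u x) (hK' : ∀ x, -K ≤ potUV α β u v x)
    {f : ℕ → ℝ} {B C : ℝ} (hfB : ∀ x, |f x| ≤ B) (hf : ∀ x, |fwdGrad u f x| ≤ C)
    {t : ℝ} (ht : 0 ≤ t) (x : ℕ) :
    bwdGrad v (fwdGrad u (semigroup (bdRates α β) t f)) x =
      feynmanKac (ratesUV α β u v) (potUV α β u v) t (bwdGrad v (fwdGrad u f)) x := by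
  have hv0 : ∀ x, 0 < v x := fun x => hε.trans_le (hv x)
  have hβ' : ∀ x, 0 ≤ β x := fun x => by
    rcases Nat.eq_zero_or_pos x with rfl | h
    exacts [hβ0.ge, (hβ x h).le]
  have hQ := isSkipFree_ratesUV hα hβ' hu hv0 hVu
  have hM := abs_bwdGrad_le hε hv hf
  have hM0 := (abs_nonneg _).trans (hM 0)
  have h1 : ∀ x, Filter.Tendsto (fun n => summedFlow α β u v n (bwdGrad v (fwdGrad u f)) t x)
      Filter.atTop (nhds (fwdGrad u (semigroup (bdRates α β) t f) x)) := by
    intro x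
    have h2 := tendsto_fwdGrad u (fun x => tendsto_reflectedFlow hα hβ0 hβ hexp hfB ht x) x
    have h3 := tendsto_summedFlow_sub hα hβ0 hβ hu hVu hε hv hK hK' hf ht x
    simpa using h3.add h2
  have h4 := tendsto_bwdGrad v h1 x
  have h5 := (integrable_and_tendsto_killedFlow hQ (potUV α β u v) (c := K) (fun _ => hM0) hM
    (fun x => by
      rw [gen_const]
      have := mul_le_mul_of_nonneg_right (hK' x) hM0
      linarith) ht x).2
  refine tendsto_nhds_unique h4 (h5.congr fun n => ?_)
  exact (bwdGrad_neg_sum hv0 _ x).symm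

end BirthDeath

theorem theorem2 (α β u v : ℕ → ℝ)
    (hα : ∀ x, 0 < α x) (hβ0 : β 0 = 0) (hβ : ∀ x, 1 ≤ x → 0 < β x)
    (herg : BirthDeath.ErgodicRates α β) (hexp : BirthDeath.NonExplosiveRates α β)
    (hu : ∀ x, 0 < u x) (hv : ∀ x, 0 < v x)
    (hVu : Antitone (BirthDeath.potU α β u))
    (hVu_bdd : BddBelow (Set.range (BirthDeath.potU α β u)))
    (hv_inf : 0 < ⨅ x, v x)
    (hVuv_bdd : BddBelow (Set.range (BirthDeath.potUV α β u v)))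
    (f : ℕ → ℝ) (hf : BddAbove (Set.range fun x => |BirthDeath.fwdGrad u f x|))
    (t : ℝ) (ht : 0 ≤ t) :
    (∀ x, MeasureTheory.Integrable (BirthDeath.valueAt (BirthDeath.bdRates α β) f x t)
      (BirthDeath.sampleLaw (BirthDeath.bdRates α β))) ∧
    (∀ x, MeasureTheory.Integrable
      (BirthDeath.feynmanKacVar (BirthDeath.ratesUV α β u v) (BirthDeath.potUV α β u v) t
        (BirthDeath.bwdGrad v (BirthDeath.fwdGrad u f)) x)
      (BirthDeath.sampleLaw (BirthDeath.ratesUV α β u v))) ∧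
    BirthDeath.bwdGrad v
        (BirthDeath.fwdGrad u (BirthDeath.semigroup (BirthDeath.bdRates α β) t f)) =
      BirthDeath.feynmanKac (BirthDeath.ratesUV α β u v) (BirthDeath.potUV α β u v) t
        (BirthDeath.bwdGrad v (BirthDeath.fwdGrad u f)) := by
  open BirthDeath in
  have hβ' : ∀ x, 0 ≤ β x := fun x => by
    rcases Nat.eq_zero_or_pos x with rfl | h
    exacts [hβ0.ge, (hβ x h).le]
  set ε := ⨅ x, v x with hε
  have hvε : ∀ x, ε ≤ v x := fun x => ciInf_le ⟨0, by rintro _ ⟨y, rfl⟩; exact (hv y).le⟩ x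
  obtain ⟨C, hC⟩ := hf
  have hfC : ∀ x, |fwdGrad u f x| ≤ C := fun x => hC ⟨x, rfl⟩
  have hC0 : 0 ≤ C := (abs_nonneg _).trans (hfC 0)
  obtain ⟨K₁, hK₁⟩ := hVu_bdd
  obtain ⟨K₂, hK₂⟩ := hVuv_bdd
  obtain ⟨K, hK0, hK, hK'⟩ : ∃ K, 0 ≤ K ∧ (∀ x, -K ≤ potU α β u x) ∧
      ∀ x, -K ≤ potUV α β u v x := by
    refine ⟨|K₁| + |K₂|, by positivity, fun x => ?_, fun x => ?_⟩
    · have h1 : K₁ ≤ potU α β u x := hK₁ ⟨x, rfl⟩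
      linarith [neg_abs_le K₁, abs_nonneg K₂]
    · have h1 : K₂ ≤ potUV α β u v x := hK₂ ⟨x, rfl⟩
      linarith [neg_abs_le K₂, abs_nonneg K₁]
  have hQ : IsSkipFree (bdRates α β) :=
    isSkipFree_bdRates hβ0 (fun x => (hα x).le) hβ' fun x => add_pos_of_pos_of_nonneg (hα x) (hβ' x)
  have hQ' := isSkipFree_ratesUV hα hβ' hu hv hVu
  -- The Lyapunov function dominating `f`.
  set F : ℕ → ℝ := fun x => ∑ k ∈ Finset.range x, u k with hF
  have hF0 : ∀ x, 0 ≤ F x := fun x => Finset.sum_nonneg fun k _ => (hu k).le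
  have hFmono : Monotone F := fun x y h =>
    Finset.sum_le_sum_of_subset_of_nonneg (Finset.range_mono h) fun k _ _ => (hu k).le
  set A := |f 0| + C with hA
  have hA0 : 0 ≤ A := by positivity
  set ψ : ℕ → ℝ := fun x => A * (1 + F x) with hψ
  have hψ0 : ∀ x, 0 ≤ ψ x := fun x => mul_nonneg hA0 (by linarith [hF0 x])
  have hfF : ∀ x, |f x| ≤ |f 0| + C * F x := by
    intro x
    induction x with
    | zero => simp [hF]
    | succ x ih =>
      have h1 : f (x + 1) = f x + fwdGrad u f x * u x := by
        rw [fwdGrad, div_mul_cancel₀ _ (hu x).ne']; ring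
      have h2 : |fwdGrad u f x * u x| ≤ C * u x := by
        rw [abs_mul, abs_of_pos (hu x)]
        exact mul_le_mul_of_nonneg_right (hfC x) (hu x).le
      have h3 : F (x + 1) = F x + u x := Finset.sum_range_succ _ _
      rw [h1, h3]
      linarith [abs_add_le (f x) (fwdGrad u f x * u x)]
  have hfψ : ∀ x, |f x| ≤ ψ x := by
    intro x
    have h1 := hfF x
    have h2 := mul_nonneg (abs_nonneg (f 0)) (hF0 x)
    simp only [hψ, hA]
    linarith
  have hψgen : ∀ x, gen (bdRates α β) 0 ψ x ≤ (α 0 * u 0 + K) * ψ x := by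
    intro x
    have h1 : bdOp α β 0 ψ x = A * bdOp α β 0 F x := by
      simp only [bdOp, hψ, Pi.zero_apply]; ring
    rw [gen_bdRates α β _ hβ0, h1, hψ, mul_left_comm]
    refine mul_le_mul_of_nonneg_left ((bdOp_sum_le hβ0 hu hK x).trans ?_) hA0
    have h2 := mul_nonneg (mul_pos (hα 0) (hu 0)).le (hF0 x)
    change _ + K * F x ≤ _
    linarith
  have hint : ∀ g : ℕ → ℝ, (∀ x, |g x| ≤ ψ x) → ∀ x,
      Integrable (valueAt (bdRates α β) g x t) (sampleLaw (bdRates α β)) := by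
    intro g hg x
    rw [← feynmanKacVar_zero]
    exact (integrable_and_tendsto_killedFlow hQ 0 hψ0 hg hψgen ht x).1
  have hint' : ∀ (g : ℕ → ℝ) (M : ℝ), 0 ≤ M → (∀ x, |g x| ≤ M) → ∀ x,
      Integrable (feynmanKacVar (ratesUV α β u v) (potUV α β u v) t g x)
        (sampleLaw (ratesUV α β u v)) := by
    intro g M hM0 hM x
    refine (integrable_and_tendsto_killedFlow hQ' (potUV α β u v) (c := K) (fun _ => hM0) hM
      (fun x => ?_) ht x).1
    rw [gen_const]
    have := mul_le_mul_of_nonneg_right (hK' x) hM0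
    linarith
  have hM0 : 0 ≤ 2 * C / ε := by positivity
  refine ⟨hint f hfψ, hint' _ _ hM0 (abs_bwdGrad_le hv_inf hvε hfC), ?_⟩
  funext x
  -- Approximation of `f` by the bounded functions `f (min · m)`.
  set fm : ℕ → ℕ → ℝ := fun m x => f (min x m) with hfm
  have hfmgrad : ∀ m x, |fwdGrad u (fm m) x| ≤ C := by
    intro m x
    rcases Nat.lt_or_ge x m with h | h
    · have : fwdGrad u (fm m) x = fwdGrad u f x := by
        simp only [fwdGrad, hfm]
        rw [min_eq_left h.le, min_eq_left (show x + 1 ≤ m from h)]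
      rw [this]; exact hfC x
    · have : fwdGrad u (fm m) x = 0 := by
        simp only [fwdGrad, hfm]
        rw [min_eq_right h, min_eq_right (by omega), sub_self, zero_div]
      rw [this, abs_zero]; exact hC0
  have hfmψ : ∀ m x, |fm m x| ≤ ψ x := fun m x =>
    (hfψ _).trans (mul_le_mul_of_nonneg_left (by linarith [hFmono (min_le_left x m)]) hA0)
  have hfmB : ∀ m x, |fm m x| ≤ ψ m := fun m x =>
    (hfψ _).trans (mul_le_mul_of_nonneg_left (by linarith [hFmono (min_le_right x m)]) hA0)
  have hfmlim : ∀ x, Filter.Tendsto (fun m => fm m x) Filter.atTop (nhds (f x)) := by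
    intro x
    refine tendsto_const_nhds.congr' ?_
    filter_upwards [Filter.eventually_ge_atTop x] with m hm
    simp only [hfm, min_eq_left hm]
  have hleft : ∀ x, Filter.Tendsto (fun m => semigroup (bdRates α β) t (fm m) x) Filter.atTop
      (nhds (semigroup (bdRates α β) t f x)) := by
    intro x
    simp only [← feynmanKac_zero]
    refine tendsto_feynmanKac hQ 0 ht x (b := ψ) ?_ hfmψ hfmlim
    rw [feynmanKacVar_zero]
    exact hint ψ (fun x => (abs_of_nonneg (hψ0 x)).le) x
  have hright := tendsto_feynmanKac hQ' (potUV α β u v) ht x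
    (hint' (fun _ => 2 * C / ε) _ hM0 (fun _ => (abs_of_nonneg hM0).le) x)
    (fun m => abs_bwdGrad_le hv_inf hvε (hfmgrad m))
    (tendsto_bwdGrad v (tendsto_fwdGrad u hfmlim))
  refine tendsto_nhds_unique (tendsto_bwdGrad v (tendsto_fwdGrad u hleft) x)
    (hright.congr fun m => ?_)
  exact (bwdGrad_fwdGrad_semigroup_of_bounded hα hβ0 hβ hexp hu hVu hv_inf hvε hK hK'
    (hfmB m) (hfmgrad m) ht x).symm
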